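/- \textbf{Setting.} Let $-1<\sigma\le 0$, $\kappa>0$, $V>0$, $T>0$. For $a<b$, call $(u,\lambda)$ with $u\in C^2([a,b])$, $\lambda\in\mathbb R$, a \emph{quasi-static profile of volume $V$ on $[a,b]$} if $$\Big(\frac{u_x}{\sqrt{1+u_x^2}}\Big)_x-\kappa u+\lambda=0\ \text{ in }(a,b),\qquad u(a)=u(b)=0,\qquad \int_a^b u\,dx=V,$$ and put $c_a(u)=\big(1+u_x(a)^2\big)^{-1/2}$, $c_b(u)=\big(1+u_x(b)^2\big)^{-1/2}$ (one-sided derivatives at the endpoints). \emph{Exact solution.} Let $a,b\in C^3([0,T])$ and, for every $t\in[0,T]$, let $(u(\cdot,t),\lambda(t))$ be a quasi-static profile of volume $V$ on $[a(t),b(t)]$ (in particular $a(t)<b(t)$), such that $$a'(t)=\sigma+c_{a(t)}(u(\cdot,t)),\qquad b'(t)=-\sigma-c_{b(t)}(u(\cdot,t)),\qquad t\in[0,T].$$ Let $u_m(t)=\max_{[a(t),b(t)]}u(\cdot,t)$, $r(t)=\tfrac12(b(t)-a(t))$, and let $C_m$ be any number with $$\frac{1}{V-r(t)\,u_m(t)}\Big(\frac{6V}{u_m(t)}+\kappa\,u_m(t)^3\Big)\le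 C_m\qquad\text{for all }t\in[0,T].$$ \emph{Predictor--corrector scheme.} Let $\Delta t>0$, $t^n=n\Delta t$, $a^0=a(0)$, $b^0=b(0)$, $u^0=u(\cdot,0)$. Given $(a^n,b^n,u^n)$: \begin{enumerate} \item (predictor) $\tilde a^{n+1}=a^n+\Delta t\,(\sigma+c_{a^n}(u^n))$, $\tilde b^{n+1}=b^n-\Delta t\,(\sigma+c_{b^n}(u^n))$, and $(\tilde u^{n+1},\tilde\lambda^{n+1})$ is a quasi-static profile of volume $\int_{a^0}^{b^0}u^0\,dx$ on $[\tilde a^{n+1},\tilde b^{n+1}]$; \item (corrector) $a^{n+1}=a^n+\Delta t\big(\sigma+\tfrac12[c_{a^n}(u^n)+c_{\tilde a^{n+1}}(\tilde u^{n+1})]\big)$, $b^{n+1}=b^n-\Delta t\big(\sigma+\tfrac12[c_{b^n}(u^n)+c_{\tilde b^{n+1}}(\tilde u^{n+1})]\big)$; \item $(u^{n+1},\lambda^{n+1})$ is a quasi-static profile of volume $\int_{a^0}^{b^0}u^0\,dx$ on $[a^{n+1},b^{n+1}]$. \end{enumerate} \textbf{Theorem (second-order convergence).} There is a constant $C>0$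 depending only on $C_m$ (and not on $\sigma,\kappa,V,T,\Delta t$ or the solution otherwise) such that, for every $n<T/\Delta t$ for which the first $n$ steps of the scheme are defined, $$|b(t^n)-b^n|\le C e^{CT}\Delta t^2,\qquad |a(t^n)-a^n|\le C e^{CT}\Delta t^2 .$$ -/

import Mathlib

open Set

noncomputable section

/-- `(u, lam)` is a quasi-static capillary profile on `[a, b]` with volume `V`: a classical solution of
`(u' / √(1 + u'²))' - κ u + lam = 0` in `(a, b)`, `u a = u b = 0`, `∫ u = V`,
with finite one-sided slopes at the contact points. -/
structure IsQuasiStaticProfile (κ V a b : ℝ) (u : ℝ → ℝ) (lam : ℝ) : Prop where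
  lt : a < b
  smooth : ContDiffOn ℝ 2 u (Icc a b)
  equation : ∀ x ∈ Ioo a b,
    deriv (fun y => deriv u y / √(1 + deriv u y ^ 2)) x - κ * u x + lam = 0
  left : u a = 0
  right : u b = 0
  volume : ∫ x in a..b, u x = V

/-- `1 / √(1 + (∂ₓu)²)` at the contact point `a`, with the one-sided derivative of `u`. -/
def cosLeft (a b : ℝ) (u : ℝ → ℝ) : ℝ :=
  1 / √(1 + derivWithin u (Icc a b) a ^ 2)

/-- `1 / √(1 + (∂ₓu)²)` at the contact point `b`, with the one-sided derivative of `u`. -/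
def cosRight (a b : ℝ) (u : ℝ → ℝ) : ℝ :=
  1 / √(1 + derivWithin u (Icc a b) b ^ 2)

/-- Quasi-static droplet dynamics on `[0, T]`: at each time `u t` is a quasi-static profile on
`[a t, b t]` with multiplier `lam t`, and the contact points move by
`a' = σ + 1 / √(1 + (∂ₓu)²)` and `b' = -σ - 1 / √(1 + (∂ₓu)²)`. -/
structure IsQuasiStaticSolution (σ κ V T : ℝ) (a b : ℝ → ℝ) (u : ℝ → ℝ → ℝ)
    (lam : ℝ → ℝ) : Prop where
  profile : ∀ t ∈ Icc 0 T, IsQuasiStaticProfile κ V (a t) (b t) (u t) (lam t)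
  left : ∀ t ∈ Icc 0 T,
    HasDerivWithinAt a (σ + cosLeft (a t) (b t) (u t)) (Icc 0 T) t
  right : ∀ t ∈ Icc 0 T,
    HasDerivWithinAt b (-σ - cosRight (a t) (b t) (u t)) (Icc 0 T) t

/-- One step of the first order scheme, from `(a, b, u)` to `(a', b', u')`: an explicit update of
the contact points, then the implicit solve for the profile and its multiplier. -/
structure IsFirstOrderStep (σ κ V Δt a b : ℝ) (u : ℝ → ℝ) (a' b' : ℝ) (u' : ℝ → ℝ)
    (lam' : ℝ) : Prop where
  left : (a' - a) / Δt = σ + cosLeft a b u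
  right : (b' - b) / Δt = -σ - cosRight a b u
  profile : IsQuasiStaticProfile κ V a' b' u' lam'

/-- The first `N` steps of the second order predictor-corrector scheme. The predictor
`(ap (n + 1), bp (n + 1), up (n + 1), lamp (n + 1))` is a first order step from `(a n, b n, u n)`;
the volume is that of the initial profile `u 0`. -/
structure IsPredictorCorrector (σ κ Δt : ℝ) (N : ℕ)
    (a b : ℕ → ℝ) (u : ℕ → ℝ → ℝ) (lam : ℕ → ℝ)
    (ap bp : ℕ → ℝ) (up : ℕ → ℝ → ℝ) (lamp : ℕ → ℝ) : Prop where
  predictor : ∀ n < N, IsFirstOrderStep σ κ (∫ x in (a 0)..(b 0), u 0 x) Δt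
    (a n) (b n) (u n) (ap (n + 1)) (bp (n + 1)) (up (n + 1)) (lamp (n + 1))
  left : ∀ n < N, (a (n + 1) - a n) / Δt =
    σ + 1 / 2 * (cosLeft (a n) (b n) (u n) +
      cosLeft (ap (n + 1)) (bp (n + 1)) (up (n + 1)))
  right : ∀ n < N, (b (n + 1) - b n) / Δt =
    -σ - 1 / 2 * (cosRight (a n) (b n) (u n) +
      cosRight (ap (n + 1)) (bp (n + 1)) (up (n + 1)))
  profile : ∀ n < N, IsQuasiStaticProfile κ (∫ x in (a 0)..(b 0), u 0 x)
    (a (n + 1)) (b (n + 1)) (u (n + 1)) (lam (n + 1))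

/-- The maximal height `u_m` of the profile `u` on `[a, b]`. -/
def maxHeight (a b : ℝ) (u : ℝ → ℝ) : ℝ := sSup (u '' Icc a b)

/-- The bound `(1 / (V - r u_m)) (6 V / u_m + κ u_m³)` on the derivative of the cosine of the
contact angle with respect to the half-width `r = (b - a) / 2`, for the profile `u` on `[a, b]`. -/
def angleSlopeBound (κ V a b : ℝ) (u : ℝ → ℝ) : ℝ :=
  1 / (V - (b - a) / 2 * maxHeight a b u) *
    (6 * V / maxHeight a b u + κ * maxHeight a b u ^ 3)

end

/-! Take the sine `y` of the inclination as coordinate along a profile. The equation becomes y' = κu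
− λ, and its first integral gives (λ − κu)² = eᵐ + 2κ(1 − cos), so the curvature is a function
`capCurv κ m` of `y` alone. A profile is therefore a symmetric cap, determined up to translation by
`m` and by the sine `s` at the contact point: its half-width is r = ∫₀ˢ dy / `capCurv`, its
multiplier is λ = `capCurv κ m s`, and integrating the equation gives κV/2 = λr − s
(`exists_isCap`). The two contact cosines equal a common value c, so exact and discrete midpoints
stay put and everything reduces to the scalar law r' = −(σ + c), where the fixed volume makes c a
function of r.

That function has to be Lipschitz, and c has to have a bounded second time derivative.
Differentiating the constraint gives dc/dr = `capSlope`. The difficulty is that its denominator is a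
difference; `capInt_mul_defect_gap` shows that at least 1/48 of the leading term survives, whence 0
≤ dc/dr ≤ 96/r. Integrated over the caps of equal volume this is the Lipschitz bound
(`capCos_sub_le_log`, `IsCap.abs_sub_le`). For the second derivative, every factor of `capSlope` has
logarithmic time derivative O(M), where M ≥ 1/r + √(2κ) (`cap_rates`, `logDerivBound_capSlope`,
`contact_regularity`).

One may take M = C_m for all profiles at once, those of the scheme included: the bound on the
initial profile alone controls 1/r + √(2κ) for every profile of the same volume (`inv_add_sqrt_le`).
The rest is the classical error analysis of Heun's method (`heun_error`). -/

namespace Capillary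

open Filter Topology MeasureTheory

/-! ### Cap integrals in the inclination variable and their derivatives -/

/-- The cosine of the inclination angle whose sine is `y`. -/
noncomputable def capCos (y : ℝ) : ℝ := √(1 - y ^ 2)

/-- The curvature of a cap at the point where the sine of the inclination is `y`; the curvature at
the apex is `exp (m / 2)`. -/
noncomputable def capCurv (κ m y : ℝ) : ℝ := √(Real.exp m + 2 * κ * (1 - capCos y))

/-- The integral of `w / capCurv ^ n` over the sines of the inclination in `[0, s]`. -/
noncomputable def capInt (κ : ℝ) (w : ℝ → ℝ) (n : ℕ) (m s : ℝ) : ℝ :=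
  ∫ y in (0)..s, w y / capCurv κ m y ^ n

/-- `√` is zero on negative numbers, so `capCos` vanishes off [-1, 1]. Continuity and the bound by 1
then hold on the whole line, and `capCurv` and `capInt` are well behaved without restricting `y`. -/
theorem continuous_capCos : Continuous capCos := by unfold capCos; fun_prop

theorem capCos_nonneg (y : ℝ) : 0 ≤ capCos y := Real.sqrt_nonneg _

theorem capCos_le_one (y : ℝ) : capCos y ≤ 1 := by
  unfold capCos
  rw [Real.sqrt_le_iff]
  constructor <;> nlinarith [sq_nonneg y]

theorem capCos_zero : capCos 0 = 1 := by simp [capCos]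

theorem capCos_neg (y : ℝ) : capCos (-y) = capCos y := by simp [capCos]

theorem capCos_sq {y : ℝ} (h0 : 0 ≤ y) (h1 : y ≤ 1) : capCos y ^ 2 = 1 - y ^ 2 :=
  Real.sq_sqrt (by nlinarith)

theorem capCos_pos {y : ℝ} (h0 : 0 ≤ y) (h1 : y < 1) : 0 < capCos y :=
  Real.sqrt_pos.2 (by nlinarith)

theorem capCos_lt_one {y : ℝ} (h0 : 0 < y) (h1 : y ≤ 1) : capCos y < 1 := by
  have := capCos_sq h0.le h1
  nlinarith [capCos_nonneg y, sq_pos_of_pos h0]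

theorem capCos_anti {x y : ℝ} (hx : 0 ≤ x) (hxy : x ≤ y) : capCos y ≤ capCos x :=
  Real.sqrt_le_sqrt (by nlinarith)

theorem hasDerivAt_capCos_of_sq_lt {y : ℝ} (h : y ^ 2 < 1) :
    HasDerivAt capCos (-(y / capCos y)) y := by
  have h2 : 0 < 1 - y ^ 2 := by linarith
  refine (((hasDerivAt_pow 2 y).const_sub 1).sqrt h2.ne').congr_deriv ?_
  have := Real.sqrt_pos.2 h2
  unfold capCos at *
  field_simp
  simp

theorem hasDerivAt_capCos {y : ℝ} (h0 : 0 ≤ y) (h1 : y < 1) :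
    HasDerivAt capCos (-(y / capCos y)) y :=
  hasDerivAt_capCos_of_sq_lt (by nlinarith)

theorem capCurv_sq_pos {κ : ℝ} (hκ : 0 < κ) (m y : ℝ) :
    0 < Real.exp m + 2 * κ * (1 - capCos y) := by
  have := capCos_le_one y
  have := Real.exp_pos m
  have : 0 ≤ 2 * κ * (1 - capCos y) := by
    apply mul_nonneg <;> linarith
  linarith

theorem capCurv_pos {κ : ℝ} (hκ : 0 < κ) (m y : ℝ) : 0 < capCurv κ m y :=
  Real.sqrt_pos.2 (capCurv_sq_pos hκ m y)

theorem capCurv_sq {κ : ℝ} (hκ : 0 < κ) (m y : ℝ) :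
    capCurv κ m y ^ 2 = Real.exp m + 2 * κ * (1 - capCos y) :=
  Real.sq_sqrt (capCurv_sq_pos hκ m y).le

theorem capCurv_neg (κ m y : ℝ) : capCurv κ m (-y) = capCurv κ m y := by
  simp [capCurv, capCos_neg]

theorem capCurv_mono {κ : ℝ} (hκ : 0 < κ) (m : ℝ) {x y : ℝ} (hx : 0 ≤ x) (hxy : x ≤ y) :
    capCurv κ m x ≤ capCurv κ m y := by
  apply Real.sqrt_le_sqrt
  have := capCos_anti hx hxy
  nlinarith

theorem exp_le_capCurv_sq {κ : ℝ} (hκ : 0 < κ) (m y : ℝ) :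
    Real.exp m ≤ capCurv κ m y ^ 2 := by
  rw [capCurv_sq hκ]
  have := capCos_le_one y
  nlinarith

theorem continuous_capCurv (κ : ℝ) : Continuous fun q : ℝ × ℝ => capCurv κ q.1 q.2 := by
  unfold capCurv
  have := continuous_capCos
  fun_prop

theorem continuous_capInt_integrand {κ : ℝ} (hκ : 0 < κ) {w : ℝ → ℝ} (hw : Continuous w) (n : ℕ) :
    Continuous (Function.uncurry fun m y : ℝ => w y / capCurv κ m y ^ n) := by
  have := continuous_capCurv κ
  have h2 : ∀ q : ℝ × ℝ, capCurv κ q.1 q.2 ^ n ≠ 0 := fun q =>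
    (pow_pos (capCurv_pos hκ _ _) n).ne'
  exact Continuous.div (by fun_prop) (by fun_prop) h2

theorem continuous_capInt_integrand_right {κ : ℝ} (hκ : 0 < κ) {w : ℝ → ℝ} (hw : Continuous w)
    (n : ℕ) (m : ℝ) : Continuous fun y : ℝ => w y / capCurv κ m y ^ n :=
  (continuous_capInt_integrand hκ hw n).comp (Continuous.prodMk_right m)

theorem continuous_capInt {κ : ℝ} (hκ : 0 < κ) {w : ℝ → ℝ} (hw : Continuous w) (n : ℕ) :
    Continuous fun q : ℝ × ℝ => capInt κ w n q.1 q.2 :=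
  intervalIntegral.continuous_parametric_primitive_of_continuous
    (continuous_capInt_integrand hκ hw n)

theorem hasDerivAt_capCurv_left {κ : ℝ} (hκ : 0 < κ) (m y : ℝ) :
    HasDerivAt (fun m => capCurv κ m y) (Real.exp m / (2 * capCurv κ m y)) m :=
  ((Real.hasDerivAt_exp m).add_const _).sqrt (capCurv_sq_pos hκ m y).ne'

theorem hasDerivAt_capCurv_right {κ : ℝ} (hκ : 0 < κ) (m : ℝ) {y : ℝ} (h0 : 0 ≤ y) (h1 : y < 1) :
    HasDerivAt (fun y => capCurv κ m y) (κ * y / (capCos y * capCurv κ m y)) y := by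
  have h := ((((hasDerivAt_capCos h0 h1).const_sub 1).const_mul (2 * κ)).const_add
    (Real.exp m)).sqrt (capCurv_sq_pos hκ m y).ne'
  refine h.congr_deriv ?_
  have h2 := capCos_pos h0 h1
  have h3 := capCurv_pos hκ m y
  change _ / (2 * capCurv κ m y) = _
  field_simp

theorem hasDerivAt_capInt_left {κ : ℝ} (hκ : 0 < κ) {w : ℝ → ℝ} (hw : Continuous w) (n : ℕ)
    (m s : ℝ) :
    HasDerivAt (fun m => capInt κ w n m s)
      (-(n / 2 * Real.exp m * capInt κ w (n + 2) m s)) m := by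
  set F' : ℝ → ℝ → ℝ := fun m y => -(n / 2 * Real.exp m) * (w y / capCurv κ m y ^ (n + 2)) with hF'
  have hd : ∀ m y, HasDerivAt (fun m => w y / capCurv κ m y ^ n) (F' m y) m := by
    intro m y
    have hp := capCurv_pos hκ m y
    have h := (((hasDerivAt_capCurv_left hκ m y).pow n).inv (pow_pos hp n).ne').const_mul (w y)
    refine (h.congr_deriv ?_).congr_of_eventuallyEq (Eventually.of_forall fun x => by
      simp [div_eq_mul_inv])
    simp only [hF']
    rcases n with _ | n
    · simp
    · simp only [Nat.add_sub_cancel, Pi.pow_apply]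
      field_simp
      ring
  have hcont : Continuous (Function.uncurry F') := by
    have := continuous_capInt_integrand hκ hw (n + 2)
    simp only [hF', Function.uncurry_def] at this ⊢
    fun_prop
  obtain ⟨B, hB⟩ := ((isCompact_Icc (a := m - 1) (b := m + 1)).prod
    (isCompact_uIcc (a := (0 : ℝ)) (b := s))).exists_bound_of_continuousOn hcont.continuousOn
  have key := (intervalIntegral.hasDerivAt_integral_of_dominated_loc_of_deriv_le (μ := volume)
    (F := fun m y => w y / capCurv κ m y ^ n) (F' := F') (x₀ := m) (s := Icc (m - 1) (m + 1))
    (a := 0) (b := s) (bound := fun _ => B) (Icc_mem_nhds (by linarith) (by linarith))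
    (Eventually.of_forall fun x =>
      (continuous_capInt_integrand_right hκ hw n x).aestronglyMeasurable)
    ((continuous_capInt_integrand_right hκ hw n m).intervalIntegrable _ _)
    (hcont.comp (Continuous.prodMk_right m)).aestronglyMeasurable
    (Eventually.of_forall fun y hy x hx => hB (x, y) ⟨hx, uIoc_subset_uIcc hy⟩)
    intervalIntegrable_const (Eventually.of_forall fun y _ x _ => hd x y)).2
  refine key.congr_deriv ?_
  simp only [hF', intervalIntegral.integral_const_mul, capInt]
  ring

theorem hasDerivAt_capInt_right {κ : ℝ} (hκ : 0 < κ) {w : ℝ → ℝ} (hw : Continuous w) (n : ℕ)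
    (m s : ℝ) :
    HasDerivAt (fun s => capInt κ w n m s) (w s / capCurv κ m s ^ n) s :=
  (continuous_capInt_integrand_right hκ hw n m).integral_hasStrictDerivAt 0 s |>.hasDerivAt

/-- Chain rule for `capInt` along a differentiable path. -/
theorem hasDerivWithinAt_capInt {κ : ℝ} (hκ : 0 < κ) {w : ℝ → ℝ} (hw : Continuous w) (n : ℕ)
    {m s : ℝ → ℝ} {m' s' t : ℝ} {S : Set ℝ} (hm : HasDerivWithinAt m m' S t)
    (hs : HasDerivWithinAt s s' S t) :
    HasDerivWithinAt (fun t => capInt κ w n (m t) (s t))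
      (m' * -(n / 2 * Real.exp (m t) * capInt κ w (n + 2) (m t) (s t)) +
        s' * (w (s t) / capCurv κ (m t) (s t) ^ n)) S t := by
  have hc1 : Continuous fun q : ℝ × ℝ => -(n / 2 * Real.exp q.1 * capInt κ w (n + 2) q.1 q.2) := by
    have := continuous_capInt hκ hw (n + 2)
    fun_prop
  have hc2 : Continuous fun q : ℝ × ℝ => w q.2 / capCurv κ q.1 q.2 ^ n :=
    continuous_capInt_integrand hκ hw n
  have h := (hasStrictFDerivAt_uncurry_coprod (𝕜 := ℝ) (u := (m t, s t))
    (f := fun m s => capInt κ w n m s)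
    (f₁ := fun m s => ContinuousLinearMap.toSpanSingleton ℝ
      (-(n / 2 * Real.exp m * capInt κ w (n + 2) m s)))
    (f₂ := fun m s => ContinuousLinearMap.toSpanSingleton ℝ (w s / capCurv κ m s ^ n))
    (Eventually.of_forall fun q => (hasDerivAt_capInt_left hκ hw n q.1 q.2).hasFDerivAt)
    (Eventually.of_forall fun q => (hasDerivAt_capInt_right hκ hw n q.1 q.2).hasFDerivAt)
    ((ContinuousLinearMap.toSpanSingletonCLE (𝕜 := ℝ) (E := ℝ)).continuous.comp hc1).continuousAt
    ((ContinuousLinearMap.toSpanSingletonCLE (𝕜 := ℝ) (E := ℝ)).continuous.comp hc2).continuousAt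
    ).hasFDerivAt
  have h2 := h.comp_hasDerivWithinAt t (hm.prodMk hs)
  refine h2.congr_deriv ?_
  simp [Function.HasUncurry.uncurry]

/-! ### Integral inequalities for the width and the defect -/

/-- Half the width of a cap. -/
noncomputable def capWidth (κ m s : ℝ) : ℝ := capInt κ (fun _ => 1) 1 m s

/-- The integral of `(capCos y - capCos s) / capCurv ^ n` over `[0, s]`. -/
noncomputable def capDefect (κ : ℝ) (n : ℕ) (m s : ℝ) : ℝ :=
  capInt κ capCos n m s - capCos s * capInt κ (fun _ => 1) n m s

theorem intervalIntegrable_capInt {κ : ℝ} (hκ : 0 < κ) {w : ℝ → ℝ} (hw : Continuous w) (n : ℕ)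
    (m a b : ℝ) : IntervalIntegrable (fun y => w y / capCurv κ m y ^ n) volume a b :=
  (continuous_capInt_integrand_right hκ hw n m).intervalIntegrable _ _

theorem capDefect_eq {κ : ℝ} (hκ : 0 < κ) (n : ℕ) (m s : ℝ) :
    capDefect κ n m s = capInt κ (fun y => capCos y - capCos s) n m s := by
  unfold capDefect capInt
  rw [← intervalIntegral.integral_const_mul, ← intervalIntegral.integral_sub]
  · congr 1; ext y; ring
  · exact intervalIntegrable_capInt hκ continuous_capCos n m 0 s
  · exact (intervalIntegrable_capInt hκ continuous_const n m 0 s).const_mul _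

theorem capInt_nonneg {κ : ℝ} (hκ : 0 < κ) {w : ℝ → ℝ} (n : ℕ) (m : ℝ) {s : ℝ} (hs : 0 ≤ s)
    (h : ∀ y ∈ Icc 0 s, 0 ≤ w y) : 0 ≤ capInt κ w n m s :=
  intervalIntegral.integral_nonneg hs fun y hy =>
    div_nonneg (h y hy) (pow_pos (capCurv_pos hκ m y) n).le

/-- Differentiation in `m` produces a factor `exp m` and raises the exponent by 2; since `exp m ≤
capCurv ^ 2`, this costs nothing. -/
theorem exp_mul_capInt_le {κ : ℝ} (hκ : 0 < κ) {w : ℝ → ℝ} (hw : Continuous w) (n : ℕ) (m : ℝ)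
    {s : ℝ} (hs : 0 ≤ s) (h : ∀ y ∈ Icc 0 s, 0 ≤ w y) :
    Real.exp m * capInt κ w (n + 2) m s ≤ capInt κ w n m s := by
  unfold capInt
  rw [← intervalIntegral.integral_const_mul]
  refine intervalIntegral.integral_mono_on hs
    ((intervalIntegrable_capInt hκ hw (n + 2) m 0 s).const_mul _)
    (intervalIntegrable_capInt hκ hw n m 0 s) fun y hy => ?_
  have hp := capCurv_pos hκ m y
  have h1 := exp_le_capCurv_sq hκ m y
  have h2 : w y / capCurv κ m y ^ n = capCurv κ m y ^ 2 * (w y / capCurv κ m y ^ (n + 2)) := by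
    field_simp
    ring
  rw [h2]
  exact mul_le_mul_of_nonneg_right h1 (div_nonneg (h y hy) (pow_pos hp _).le)

theorem div_le_capInt_one {κ : ℝ} (hκ : 0 < κ) (n : ℕ) (m : ℝ) {s : ℝ} (hs : 0 ≤ s) :
    s / capCurv κ m s ^ n ≤ capInt κ (fun _ => 1) n m s := by
  have h : ∫ _ in (0)..s, 1 / capCurv κ m s ^ n = s / capCurv κ m s ^ n := by
    simp [div_eq_mul_inv]
  rw [← h]
  refine intervalIntegral.integral_mono_on hs intervalIntegrable_const
    (intervalIntegrable_capInt hκ continuous_const n m 0 s) fun y hy => ?_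
  have := capCurv_pos hκ m y
  have := capCurv_mono hκ m hy.1 hy.2
  gcongr

theorem capInt_one_pos {κ : ℝ} (hκ : 0 < κ) (n : ℕ) (m : ℝ) {s : ℝ} (hs : 0 < s) :
    0 < capInt κ (fun _ => 1) n m s :=
  (div_pos hs (pow_pos (capCurv_pos hκ m s) n)).trans_le (div_le_capInt_one hκ n m hs.le)

theorem capWidth_pos {κ : ℝ} (hκ : 0 < κ) (m : ℝ) {s : ℝ} (hs : 0 < s) : 0 < capWidth κ m s :=
  capInt_one_pos hκ 1 m hs

theorem le_capWidth_mul {κ : ℝ} (hκ : 0 < κ) (m : ℝ) {s : ℝ} (hs : 0 < s) :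
    s ≤ capWidth κ m s * capCurv κ m s := by
  have h := div_le_capInt_one hκ 1 m hs.le
  rw [pow_one, div_le_iff₀ (capCurv_pos hκ m s)] at h
  exact h

theorem capCurv_sq_sub {κ : ℝ} (hκ : 0 < κ) (m s y : ℝ) :
    capCurv κ m s ^ 2 - capCurv κ m y ^ 2 = 2 * κ * (capCos y - capCos s) := by
  rw [capCurv_sq hκ, capCurv_sq hκ]; ring

/-- Comes from L² − `capCurv`(y)² = 2κ(cos y − cos s) under the integral. It is how `capDefect`
enters the derivative of the volume. -/
theorem capCurv_sq_mul_sub {κ : ℝ} (hκ : 0 < κ) (m s : ℝ) :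
    capCurv κ m s ^ 2 * capInt κ (fun _ => 1) 3 m s - capWidth κ m s =
      2 * κ * capDefect κ 3 m s := by
  rw [capDefect_eq hκ]
  unfold capWidth capInt
  rw [← intervalIntegral.integral_const_mul, ← intervalIntegral.integral_const_mul,
    ← intervalIntegral.integral_sub]
  · congr 1; ext y
    have hp := capCurv_pos hκ m y
    rw [← mul_div_assoc, ← mul_div_assoc, ← capCurv_sq_sub hκ]
    field_simp
  · exact (intervalIntegrable_capInt hκ continuous_const 3 m 0 s).const_mul _
  · exact intervalIntegrable_capInt hκ continuous_const 1 m 0 s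

theorem capDefect_nonneg {κ : ℝ} (hκ : 0 < κ) (n : ℕ) (m : ℝ) {s : ℝ} (hs : 0 ≤ s) :
    0 ≤ capDefect κ n m s := by
  rw [capDefect_eq hκ]
  exact capInt_nonneg hκ n m hs fun y hy => sub_nonneg.2 (capCos_anti hy.1 hy.2)

theorem capDefect_le {κ : ℝ} (hκ : 0 < κ) (m : ℝ) {s : ℝ} (hs : 0 ≤ s) :
    capDefect κ 3 m s ≤ (1 - capCos s) * capInt κ (fun _ => 1) 3 m s := by
  rw [capDefect_eq hκ]
  unfold capInt
  rw [← intervalIntegral.integral_const_mul]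
  refine intervalIntegral.integral_mono_on hs
    (intervalIntegrable_capInt hκ (continuous_capCos.sub continuous_const) 3 m 0 s)
    ((intervalIntegrable_capInt hκ continuous_const 3 m 0 s).const_mul _) fun y hy => ?_
  have := capCurv_pos hκ m y
  rw [mul_one_div]
  have := capCos_le_one y
  dsimp only
  gcongr

/-- Concavity of the cosine as a function of the sine. -/
theorem capCos_chord {s y : ℝ} (hs : 0 < s) (hs1 : s < 1) (hy : 0 ≤ y) (hys : y ≤ s) :
    1 - (1 - capCos s) * (y / s) ≤ capCos y := by
  have h1 : y / s ≤ 1 := (div_le_one hs).2 hys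
  have h0 : 0 ≤ y / s := by positivity
  obtain ⟨η, hη⟩ : ∃ η, η = y / s := ⟨_, rfl⟩
  have hy' : y = η * s := by rw [hη]; field_simp
  rw [← hη] at h0 h1 ⊢
  have hc := capCos_sq hs.le hs1.le
  have hc1 := capCos_le_one s
  apply Real.le_sqrt_of_sq_le
  rw [hy']
  have : (η * s) ^ 2 = η ^ 2 * (1 - capCos s ^ 2) := by rw [hc]; ring
  rw [this]
  nlinarith [mul_nonneg (mul_nonneg h0 (sub_nonneg.2 h1)) (sub_nonneg.2 hc1)]

/-- The chord bound reduces the claim to ∫ (1 − 2y/s) / `capCurv`³ ≥ 0. This is Chebyshev's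
argument: 1 − 2y/s has mean zero and changes sign at s/2, while the weight decreases, so the weight
may be frozen at its value at s/2. -/
theorem mul_le_two_mul_capDefect {κ : ℝ} (hκ : 0 < κ) (m : ℝ) {s : ℝ} (hs : 0 < s) (hs1 : s < 1) :
    (1 - capCos s) * capInt κ (fun _ => 1) 3 m s ≤ 2 * capDefect κ 3 m s := by
  set P := capCurv κ m (s / 2) with hP
  have hPp : 0 < P := capCurv_pos hκ _ _
  have hz : ∫ y in (0)..s, (1 - capCos s) * ((1 - 2 * (y / s)) / P ^ 3) = 0 := by
    have : ∀ y, (1 - capCos s) * ((1 - 2 * (y / s)) / P ^ 3) =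
        (1 - capCos s) / P ^ 3 - 2 * (1 - capCos s) / (s * P ^ 3) * y := by
      intro y; field_simp
    simp_rw [this]
    rw [intervalIntegral.integral_sub (f := fun _ => (1 - capCos s) / P ^ 3)
      (g := fun y => 2 * (1 - capCos s) / (s * P ^ 3) * y) intervalIntegrable_const
      (by apply Continuous.intervalIntegrable; fun_prop),
      intervalIntegral.integral_const_mul]
    simp
    field_simp
    ring
  rw [capDefect_eq hκ]
  unfold capInt
  rw [← sub_nonneg, ← intervalIntegral.integral_const_mul, ← intervalIntegral.integral_const_mul,
    ← intervalIntegral.integral_sub]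
  rotate_left
  · exact (intervalIntegrable_capInt hκ (continuous_capCos.sub continuous_const) 3 m 0 s).const_mul _
  · exact (intervalIntegrable_capInt hκ continuous_const 3 m 0 s).const_mul _
  refine hz.symm.le.trans ?_
  refine intervalIntegral.integral_mono_on hs.le
    (by apply Continuous.intervalIntegrable; fun_prop)
    (((intervalIntegrable_capInt hκ (continuous_capCos.sub continuous_const) 3 m 0 s).const_mul
      _).sub ((intervalIntegrable_capInt hκ continuous_const 3 m 0 s).const_mul _)) fun y hy => ?_
  have hp := capCurv_pos hκ m y
  have hc1 := capCos_le_one s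
  have hch := capCos_chord hs hs1 hy.1 hy.2
  calc (1 - capCos s) * ((1 - 2 * (y / s)) / P ^ 3)
      ≤ (1 - capCos s) * ((1 - 2 * (y / s)) / capCurv κ m y ^ 3) := by
        apply mul_le_mul_of_nonneg_left _ (sub_nonneg.2 hc1)
        rcases le_total y (s / 2) with h | h
        · have h2 : 0 ≤ 1 - 2 * (y / s) := by
            rw [sub_nonneg, ← mul_div_assoc, div_le_one hs]; linarith
          have := capCurv_mono hκ m hy.1 h
          gcongr
        · have h2 : 1 - 2 * (y / s) ≤ 0 := by
            rw [sub_nonpos, ← mul_div_assoc, one_le_div hs]; linarith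
          have h3 := capCurv_mono hκ m (by positivity) h
          rw [div_le_div_iff₀ (by positivity) (by positivity)]
          apply mul_le_mul_of_nonpos_left _ h2
          gcongr
    _ ≤ 2 * ((capCos y - capCos s) / capCurv κ m y ^ 3) - (1 - capCos s) * (1 / capCurv κ m y ^ 3) := by
        have h : 2 * ((capCos y - capCos s) / capCurv κ m y ^ 3) -
            (1 - capCos s) * (1 / capCurv κ m y ^ 3) =
            (2 * (capCos y - capCos s) - (1 - capCos s)) / capCurv κ m y ^ 3 := by ring
        rw [h, ← mul_div_assoc]
        gcongr
        nlinarith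

theorem capDefect_pos {κ : ℝ} (hκ : 0 < κ) (m : ℝ) {s : ℝ} (hs : 0 < s) (hs1 : s < 1) :
    0 < capDefect κ 3 m s := by
  have := mul_le_two_mul_capDefect hκ m hs hs1
  have h2 : 0 < (1 - capCos s) * capInt κ (fun _ => 1) 3 m s :=
    mul_pos (sub_pos.2 (capCos_lt_one hs hs1.le)) (capInt_one_pos hκ 3 m hs)
  linarith

/-- The difference of the two sides vanishes at 0 and has derivative κ(1 − cos)² / (cos ·
`capCurv`³) ≥ 0. It serves as a lower bound for `exp m`, which divides in the rate of `m`. -/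
theorem div_le_exp_mul_capInt {κ : ℝ} (hκ : 0 < κ) (m : ℝ) {s : ℝ} (hs : 0 ≤ s) (hs1 : s < 1) :
    s / capCurv κ m s ≤ Real.exp m * capInt κ (fun _ => 1) 3 m s := by
  set g : ℝ → ℝ := fun s => Real.exp m * capInt κ (fun _ => 1) 3 m s - s / capCurv κ m s with hg
  have hd : ∀ x ∈ Ico (0 : ℝ) 1,
      HasDerivAt g (κ * (1 - capCos x) ^ 2 / (capCos x * capCurv κ m x ^ 3)) x := by
    intro x hx
    have hp := capCurv_pos hκ m x
    have hc := capCos_pos hx.1 hx.2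
    refine (((hasDerivAt_capInt_right hκ continuous_const 3 m x).const_mul (Real.exp m)).sub
      ((hasDerivAt_id x).div (hasDerivAt_capCurv_right hκ m hx.1 hx.2) hp.ne')).congr_deriv ?_
    have h1 := capCurv_sq hκ m x
    have h2 : x ^ 2 = 1 - capCos x ^ 2 := by rw [capCos_sq hx.1 hx.2.le]; ring
    have h3 : Real.exp m = capCurv κ m x ^ 2 - 2 * κ * (1 - capCos x) := by rw [h1]; ring
    simp only [id]
    rw [h3]
    field_simp
    rw [h2]
    ring
  have hm : MonotoneOn g (Ico 0 1) := by
    apply monotoneOn_of_deriv_nonneg (convex_Ico 0 1)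
    · exact fun x hx => (hd x hx).continuousAt.continuousWithinAt
    · intro x hx
      rw [interior_Ico] at hx
      exact (hd x ⟨hx.1.le, hx.2⟩).differentiableAt.differentiableWithinAt
    · intro x hx
      rw [interior_Ico] at hx
      rw [(hd x ⟨hx.1.le, hx.2⟩).deriv]
      have hp := capCurv_pos hκ m x
      have hc := capCos_pos hx.1.le hx.2
      positivity
  have h0 : g 0 = 0 := by simp [hg, capInt]
  have := hm ⟨le_rfl, one_pos⟩ ⟨hs, hs1⟩ hs
  rw [h0] at this
  simpa [hg] using this

theorem one_sub_capCos_le_sq {y : ℝ} (h0 : 0 ≤ y) (h1 : y ≤ 1) : 1 - capCos y ≤ y ^ 2 := by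
  have := capCos_sq h0 h1
  nlinarith [capCos_nonneg y, capCos_le_one y]

/-- The curvature varies by at most √(2κ) s over [0, s], because its square varies by at most 2κs².
Dividing by s r gives L/s ≤ 1/r + √(2κ), the source of that combination in all later bounds. -/
theorem capWidth_mul_sub_le {κ : ℝ} (hκ : 0 < κ) (m : ℝ) {s : ℝ} (hs : 0 ≤ s) (hs1 : s ≤ 1) :
    capWidth κ m s * capCurv κ m s - s ≤ √(2 * κ) * s * capWidth κ m s := by
  have h1 : capWidth κ m s * (capCurv κ m s - √(2 * κ) * s) ≤ ∫ _ in (0)..s, (1 : ℝ) := by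
    unfold capWidth capInt
    rw [← intervalIntegral.integral_mul_const]
    refine intervalIntegral.integral_mono_on hs
      ((intervalIntegrable_capInt hκ continuous_const 1 m 0 s).mul_const _)
      intervalIntegrable_const fun y hy => ?_
    have hp := capCurv_pos hκ m y
    rw [pow_one, div_mul_eq_mul_div, one_mul, div_le_one hp, sub_le_iff_le_add]
    apply le_of_sq_le_sq _ (by positivity)
    have h2 := capCurv_sq_sub hκ m s y
    have h3 := one_sub_capCos_le_sq hs hs1
    have h4 := capCos_le_one y
    have h5 : (√(2 * κ)) ^ 2 = 2 * κ := Real.sq_sqrt (by positivity)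
    have h6 : 0 ≤ capCurv κ m y * (√(2 * κ) * s) := by positivity
    nlinarith
  rw [intervalIntegral.integral_const, sub_zero, smul_eq_mul, mul_one] at h1
  linarith

theorem capCurv_sq_le_chord {κ : ℝ} (hκ : 0 < κ) (m : ℝ) {s y : ℝ} (hs : 0 < s) (hs1 : s < 1)
    (hy : 0 ≤ y) (hys : y ≤ s) :
    capCurv κ m y ^ 2 ≤ Real.exp m + (capCurv κ m s ^ 2 - Real.exp m) * (y / s) ^ 2 := by
  have h1 : 1 - capCos y ≤ (1 - capCos s) * (y / s) ^ 2 := by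
    rw [div_pow, ← mul_div_assoc, le_div_iff₀ (by positivity)]
    have h2 : s ^ 2 = 1 - capCos s ^ 2 := by rw [capCos_sq hs.le hs1.le]; ring
    have h3 : y ^ 2 = 1 - capCos y ^ 2 := by rw [capCos_sq hy (by linarith)]; ring
    rw [h2, h3]
    have h4 := capCos_anti hy hys
    have h5 := capCos_le_one y
    have h6 := capCos_nonneg s
    nlinarith [mul_nonneg (mul_nonneg (sub_nonneg.2 h5) (sub_nonneg.2 (h4.trans h5)))
      (sub_nonneg.2 h4)]
  rw [capCurv_sq hκ, capCurv_sq hκ]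
  nlinarith

/-- When the apex is much flatter than the contact point, r L exceeds s by a fixed factor. With q =
`capCurv` / L, convexity gives 1/q ≥ (3 − q²)/2, and q² ≤ 1/4 + (3/4)(y/s)²; the resulting quadratic
integrates to 5s/4. -/
theorem five_fourths_mul_le_capWidth_mul {κ : ℝ} (hκ : 0 < κ) (m : ℝ) {s : ℝ} (hs : 0 < s)
    (hs1 : s < 1) (h : Real.exp m ≤ capCurv κ m s ^ 2 / 4) :
    5 / 4 * s ≤ capWidth κ m s * capCurv κ m s := by
  set R := capWidth κ m s with hR
  set L := capCurv κ m s with hL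
  have hLp : 0 < L := capCurv_pos hκ m s
  have h2 : ∫ y in (0)..s, (11 / 8 - 3 / 8 * (y / s) ^ 2) ≤ R * L := by
    rw [hR]
    unfold capWidth capInt
    rw [← intervalIntegral.integral_mul_const]
    refine intervalIntegral.integral_mono_on hs.le
      (by apply Continuous.intervalIntegrable; fun_prop)
      ((intervalIntegrable_capInt hκ continuous_const 1 m 0 s).mul_const _) fun y hy => ?_
    have hp := capCurv_pos hκ m y
    have h3 := capCurv_sq_le_chord hκ m hs hs1 hy.1 hy.2
    rw [← hL] at h3
    have hη : (y / s) ^ 2 ≤ 1 := by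
      have : y / s ≤ 1 := (div_le_one hs).2 hy.2
      have : 0 ≤ y / s := div_nonneg hy.1 hs.le
      nlinarith
    have h4 : capCurv κ m y ^ 2 ≤ L ^ 2 * (1 / 4 + 3 / 4 * (y / s) ^ 2) := by nlinarith
    dsimp only
    rw [pow_one, one_div_mul_eq_div, le_div_iff₀ hp]
    obtain ⟨q, hq⟩ : ∃ q, capCurv κ m y = q * L := ⟨capCurv κ m y / L, by field_simp⟩
    have hqp : 0 < q := by rw [hq] at hp; exact pos_of_mul_pos_left hp hLp.le
    rw [hq] at h4 ⊢
    have h5 : q ^ 2 ≤ 1 / 4 + 3 / 4 * (y / s) ^ 2 := by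
      have : L ^ 2 * q ^ 2 ≤ L ^ 2 * (1 / 4 + 3 / 4 * (y / s) ^ 2) := by nlinarith
      exact le_of_mul_le_mul_left this (by positivity)
    have h6 : (11 / 8 - 3 / 8 * (y / s) ^ 2) ≤ (3 - q ^ 2) / 2 := by linarith
    have h7 : (3 - q ^ 2) / 2 * q ≤ 1 := by
      nlinarith [mul_nonneg (sq_nonneg (q - 1)) (by linarith : 0 ≤ q + 2)]
    have h8 : (11 / 8 - 3 / 8 * (y / s) ^ 2) * q ≤ 1 := by nlinarith
    nlinarith
  have h3 : ∫ y in (0)..s, (11 / 8 - 3 / 8 * (y / s) ^ 2) = 5 / 4 * s := by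
    simp_rw [div_pow, div_eq_mul_inv]
    rw [intervalIntegral.integral_sub (by simp) (by
      apply Continuous.intervalIntegrable; fun_prop)]
    simp
    field_simp
    ring
  linarith

/-- When the curvature stays within a factor 2 of L, the gap ∫ (1 − cos y) / `capCurv`³ is at least
s³/(6L³), while J ≤ 8s/L³; hence 48 = 6 · 8. -/
theorem sq_mul_capInt_le_defect_gap {κ : ℝ} (hκ : 0 < κ) (m : ℝ) {s : ℝ} (hs : 0 < s)
    (hs1 : s < 1) (h : capCurv κ m s ^ 2 / 4 ≤ Real.exp m) :
    s ^ 2 * capInt κ (fun _ => 1) 3 m s / 48 ≤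
      (1 - capCos s) * capInt κ (fun _ => 1) 3 m s - capDefect κ 3 m s := by
  set J := capInt κ (fun _ => 1) 3 m s with hJ
  set c := capCos s with hc
  set L := capCurv κ m s with hL
  set I := capDefect κ 3 m s with hI
  have hLp : 0 < L := capCurv_pos hκ m s
  have h1 : J ≤ 8 * s / L ^ 3 := by
    have h2 : ∫ _ in (0)..s, 8 / L ^ 3 = 8 * s / L ^ 3 := by simp; ring
    rw [← h2]
    refine intervalIntegral.integral_mono_on hs.le
      (intervalIntegrable_capInt hκ continuous_const 3 m 0 s) intervalIntegrable_const
      fun y hy => ?_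
    have hp := capCurv_pos hκ m y
    have h3 := exp_le_capCurv_sq hκ m y
    have h4 : L / 2 ≤ capCurv κ m y := by
      apply le_of_sq_le_sq _ hp.le
      nlinarith
    have h5 : (L / 2) ^ 3 ≤ capCurv κ m y ^ 3 := by gcongr
    rw [div_le_div_iff₀ (by positivity) (by positivity)]
    nlinarith
  have h2 : s ^ 3 / (6 * L ^ 3) ≤ (1 - c) * J - I := by
    have h3 : ∫ y in (0)..s, y ^ 2 * (1 / (2 * L ^ 3)) = s ^ 3 / (6 * L ^ 3) := by
      rw [intervalIntegral.integral_mul_const]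
      simp
      field_simp
      ring
    rw [← h3, hI, capDefect_eq hκ, hJ]
    unfold capInt
    rw [← intervalIntegral.integral_const_mul, ← intervalIntegral.integral_sub]
    · refine intervalIntegral.integral_mono_on hs.le
        (by apply Continuous.intervalIntegrable; fun_prop)
        (((intervalIntegrable_capInt hκ continuous_const 3 m 0 s).const_mul _).sub
          (intervalIntegrable_capInt hκ (continuous_capCos.sub continuous_const) 3 m 0 s))
        fun y hy => ?_
      have hp := capCurv_pos hκ m y
      have h4 := capCurv_mono hκ m hy.1 hy.2
      rw [← hL] at h4
      have h5 : y ^ 2 / 2 ≤ 1 - capCos y := by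
        have := capCos_sq hy.1 (hy.2.trans hs1.le)
        nlinarith [sq_nonneg (1 - capCos y)]
      rw [mul_one_div, mul_one_div, ← sub_div]
      have h6 : y ^ 2 / (2 * L ^ 3) = y ^ 2 / 2 / L ^ 3 := by rw [div_div]
      rw [h6]
      have h7 : 1 - c - (capCos y - capCos s) = 1 - capCos y := by rw [hc]; ring
      rw [h7]
      have : 0 ≤ 1 - capCos y := le_trans (by positivity) h5
      gcongr
    · exact (intervalIntegrable_capInt hκ continuous_const 3 m 0 s).const_mul _
    · exact intervalIntegrable_capInt hκ (continuous_capCos.sub continuous_const) 3 m 0 s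
  have : s ^ 2 * J ≤ s ^ 2 * (8 * s / L ^ 3) := by gcongr
  have h4 : s ^ 2 * (8 * s / L ^ 3) / 48 = s ^ 3 / (6 * L ^ 3) := by field_simp; ring
  linarith

/-- The crude bounds I ≤ (1 − c)J and rL ≥ s give only 2Ic ≤ 2c(1 − c)J ≤ (1 + c)(1 − c)J ≤ J r s L,
without room as c → 1. A uniform margin comes from improving the second bound for a flat apex and
the first one otherwise. -/
theorem capInt_mul_defect_gap {κ : ℝ} (hκ : 0 < κ) (m : ℝ) {s : ℝ} (hs : 0 < s) (hs1 : s < 1) :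
    2 * capDefect κ 3 m s * capCos s ≤ 47 / 48 *
      (capInt κ (fun _ => 1) 3 m s * (capWidth κ m s * s * capCurv κ m s)) := by
  set J := capInt κ (fun _ => 1) 3 m s with hJ
  set R := capWidth κ m s with hR
  set c := capCos s with hc
  set L := capCurv κ m s with hL
  set I := capDefect κ 3 m s with hI
  have hLp : 0 < L := capCurv_pos hκ m s
  have hJp : 0 < J := capInt_one_pos hκ 3 m hs
  have hc0 : 0 < c := capCos_pos hs.le hs1
  have hc1 : c < 1 := capCos_lt_one hs hs1.le
  have hIJ : I ≤ (1 - c) * J := capDefect_le hκ m hs.le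
  have hs2 : s ^ 2 = 1 - c ^ 2 := by rw [hc, capCos_sq hs.le hs1.le]; ring
  have hRL : s ≤ R * L := le_capWidth_mul hκ m hs
  have hIc : I * c ≤ (1 - c) * J * c := by gcongr
  rcases le_total (Real.exp m) (L ^ 2 / 4) with h | h
  · have h1 : 5 / 4 * s ≤ R * L := five_fourths_mul_le_capWidth_mul hκ m hs hs1 h
    have h2 : J * (5 / 4 * s) * s ≤ J * (R * L) * s := by gcongr
    have h3 : J * s ^ 2 = (1 - c) * (1 + c) * J := by rw [hs2]; ring
    have h4 : 0 ≤ (1 - c) * J := by nlinarith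
    nlinarith
  · have h1 := sq_mul_capInt_le_defect_gap hκ m hs hs1 h
    have h4 : I ≤ (1 - c) * J - s ^ 2 * J / 48 := by linarith
    have h5 : I * c ≤ ((1 - c) * J - s ^ 2 * J / 48) * c := by gcongr
    have h6 : J * s * s ≤ J * (R * L) * s := by
      have : J * s ≤ J * (R * L) := by gcongr
      gcongr
    have h7 : s ^ 2 * J = (1 - c) * (1 + c) * J := by rw [hs2]; ring
    have h8 : 0 ≤ (1 - c) * J := by nlinarith
    have h9 : 0 ≤ (1 - c) * J * (47 - 47 * c + 2 * c ^ 2) := by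
      apply mul_nonneg h8; nlinarith
    nlinarith

/-! ### Caps of fixed volume as a one-parameter family -/

/-- `κ / 2` times the volume of a cap. -/
noncomputable def capVol (κ m s : ℝ) : ℝ := capWidth κ m s * capCurv κ m s - s

theorem hasDerivWithinAt_capCos {s : ℝ → ℝ} {s' t : ℝ} {S : Set ℝ}
    (hs : HasDerivWithinAt s s' S t) (h0 : 0 ≤ s t) (h1 : s t < 1) :
    HasDerivWithinAt (fun τ => capCos (s τ)) (-(s t / capCos (s t)) * s') S t :=
  (hasDerivAt_capCos h0 h1).comp_hasDerivWithinAt t hs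

theorem hasDerivWithinAt_capCurv {κ : ℝ} (hκ : 0 < κ) {m s : ℝ → ℝ} {m' s' t : ℝ} {S : Set ℝ}
    (hm : HasDerivWithinAt m m' S t) (hs : HasDerivWithinAt s s' S t) (h0 : 0 ≤ s t)
    (h1 : s t < 1) :
    HasDerivWithinAt (fun τ => capCurv κ (m τ) (s τ))
      ((Real.exp (m t) * m' + 2 * κ * (s t / capCos (s t) * s')) /
        (2 * capCurv κ (m t) (s t))) S t := by
  have h := (hm.exp.add (((hasDerivWithinAt_capCos hs h0 h1).const_sub 1).const_mul (2 * κ))).sqrt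
    (capCurv_sq_pos hκ (m t) (s t)).ne'
  refine h.congr_deriv ?_
  simp only [capCurv, neg_mul, neg_neg, Pi.add_apply]

theorem hasDerivWithinAt_capWidth {κ : ℝ} (hκ : 0 < κ) {m s : ℝ → ℝ} {m' s' t : ℝ} {S : Set ℝ}
    (hm : HasDerivWithinAt m m' S t) (hs : HasDerivWithinAt s s' S t) :
    HasDerivWithinAt (fun τ => capWidth κ (m τ) (s τ))
      (-(Real.exp (m t) * m' * capInt κ (fun _ => 1) 3 (m t) (s t) / 2) +
        s' / capCurv κ (m t) (s t)) S t := by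
  refine (hasDerivWithinAt_capInt hκ continuous_const 1 hm hs).congr_deriv ?_
  simp
  ring

theorem hasDerivWithinAt_capVol {κ : ℝ} (hκ : 0 < κ) {m s : ℝ → ℝ} {m' s' t : ℝ} {S : Set ℝ}
    (hm : HasDerivWithinAt m m' S t) (hs : HasDerivWithinAt s s' S t) (h0 : 0 ≤ s t)
    (h1 : s t < 1) :
    HasDerivWithinAt (fun τ => capVol κ (m τ) (s τ))
      (κ / capCurv κ (m t) (s t) * (capWidth κ (m t) (s t) * (s t / capCos (s t)) * s' -
        Real.exp (m t) * m' * capDefect κ 3 (m t) (s t))) S t := by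
  have h := ((hasDerivWithinAt_capWidth hκ hm hs).mul
    (hasDerivWithinAt_capCurv hκ hm hs h0 h1)).sub hs
  refine h.congr_deriv ?_
  have hp := capCurv_pos hκ (m t) (s t)
  have hc := capCos_pos h0 h1
  have h2 := capCurv_sq_mul_sub hκ (m t) (s t)
  have h3 : κ * capDefect κ 3 (m t) (s t) = (capCurv κ (m t) (s t) ^ 2 *
    capInt κ (fun _ => 1) 3 (m t) (s t) - capWidth κ (m t) (s t)) / 2 := by linarith
  have h4 : ∀ A B : ℝ, κ / capCurv κ (m t) (s t) * (A - B * capDefect κ 3 (m t) (s t)) =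
    (κ * A - B * (κ * capDefect κ 3 (m t) (s t))) / capCurv κ (m t) (s t) := by intros; ring
  rw [h4, h3]
  field_simp
  ring

/-- Along a differentiable family of caps of constant volume, the rates of change of the parameters
and of the width are proportional. -/
theorem cap_path {κ v : ℝ} (hκ : 0 < κ) {m s : ℝ → ℝ} {m' s' t : ℝ} {S : Set ℝ}
    (hS : UniqueDiffWithinAt ℝ S t) (ht : t ∈ S) (hm : HasDerivWithinAt m m' S t)
    (hs : HasDerivWithinAt s s' S t) (h0 : 0 < s t) (h1 : s t < 1)
    (hv : ∀ τ ∈ S, capVol κ (m τ) (s τ) = v) :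
    Real.exp (m t) * m' * capDefect κ 3 (m t) (s t) =
        capWidth κ (m t) (s t) * (s t / capCos (s t)) * s' ∧
      ∃ r', HasDerivWithinAt (fun τ => capWidth κ (m τ) (s τ)) r' S t ∧
        2 * capDefect κ 3 (m t) (s t) * capCos (s t) * capCurv κ (m t) (s t) * r' =
          -s' * (capInt κ (fun _ => 1) 3 (m t) (s t) *
            (capWidth κ (m t) (s t) * s t * capCurv κ (m t) (s t)) -
              2 * capDefect κ 3 (m t) (s t) * capCos (s t)) := by
  have hp := capCurv_pos hκ (m t) (s t)
  have hc := capCos_pos h0.le h1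
  have hd := hasDerivWithinAt_capVol hκ hm hs h0.le h1
  have hz : HasDerivWithinAt (fun τ => capVol κ (m τ) (s τ)) 0 S t :=
    (hasDerivWithinAt_const t S v).congr_of_mem (fun τ hτ => hv τ hτ) ht
  -- The vanishing derivative of the volume ties m' to s'; substituting it into the derivative of
  -- the width eliminates m'.
  have he := hS.eq_deriv _ hd hz
  have hκp : κ / capCurv κ (m t) (s t) ≠ 0 := by positivity
  have he2 := sub_eq_zero.1 ((mul_eq_zero.1 he).resolve_left hκp)
  refine ⟨he2.symm, _, hasDerivWithinAt_capWidth hκ hm hs, ?_⟩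
  have h4 : ∀ E I J c L s' : ℝ, L ≠ 0 → 2 * I * c * L * (-(E * J / 2) + s' / L) =
      -(c * L * J * (E * I)) + 2 * I * c * s' := by
    intro E I J c L s' hL; field_simp
  rw [h4 _ _ _ _ _ _ hp.ne', ← he2]
  field_simp
  ring

theorem hasDerivAt_capVol_left {κ : ℝ} (hκ : 0 < κ) (m : ℝ) {s : ℝ} (h0 : 0 ≤ s) (h1 : s < 1) :
    HasDerivAt (fun m => capVol κ m s)
      (-(κ / capCurv κ m s * (Real.exp m * capDefect κ 3 m s))) m := by
  rw [← hasDerivWithinAt_univ]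
  refine (hasDerivWithinAt_capVol hκ (hasDerivWithinAt_id m univ)
    (hasDerivWithinAt_const m univ s) h0 h1).congr_deriv ?_
  simp

theorem hasDerivAt_capVol_right {κ : ℝ} (hκ : 0 < κ) (m : ℝ) {s : ℝ} (h0 : 0 ≤ s) (h1 : s < 1) :
    HasDerivAt (fun s => capVol κ m s)
      (κ / capCurv κ m s * (capWidth κ m s * (s / capCos s))) s := by
  rw [← hasDerivWithinAt_univ]
  refine (hasDerivWithinAt_capVol hκ (hasDerivWithinAt_const s univ m)
    (hasDerivWithinAt_id s univ) h0 h1).congr_deriv ?_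
  simp

theorem strictAnti_capVol {κ : ℝ} (hκ : 0 < κ) {s : ℝ} (h0 : 0 < s) (h1 : s < 1) :
    StrictAnti fun m => capVol κ m s := by
  apply strictAnti_of_deriv_neg
  intro m
  rw [(hasDerivAt_capVol_left hκ m h0.le h1).deriv]
  have := capCurv_pos hκ m s
  have := capDefect_pos hκ m h0 h1
  have : 0 < κ / capCurv κ m s * (Real.exp m * capDefect κ 3 m s) := by positivity
  linarith

theorem monotoneOn_capVol {κ : ℝ} (hκ : 0 < κ) (m : ℝ) :
    MonotoneOn (fun s => capVol κ m s) (Ico 0 1) := by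
  have hd : ∀ s ∈ Ico (0 : ℝ) 1, _ := fun s hs => hasDerivAt_capVol_right hκ m hs.1 hs.2
  apply monotoneOn_of_deriv_nonneg (convex_Ico 0 1)
  · exact fun s hs => (hd s hs).continuousAt.continuousWithinAt
  · exact fun s hs => (hd s (interior_subset hs)).differentiableAt.differentiableWithinAt
  · intro s hs
    rw [(hd s (interior_subset hs)).deriv]
    rw [interior_Ico] at hs
    have := capCurv_pos hκ m s
    have := capWidth_pos hκ m hs.1
    have := capCos_pos hs.1.le hs.2
    have := hs.1
    positivity

theorem continuous_capWidth {κ : ℝ} (hκ : 0 < κ) :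
    Continuous fun q : ℝ × ℝ => capWidth κ q.1 q.2 :=
  continuous_capInt hκ continuous_const 1

theorem continuous_capDefect {κ : ℝ} (hκ : 0 < κ) (n : ℕ) :
    Continuous fun q : ℝ × ℝ => capDefect κ n q.1 q.2 := by
  have h1 := continuous_capInt hκ continuous_capCos n
  have h2 := continuous_capInt hκ (continuous_const (y := (1 : ℝ))) n
  have h3 := continuous_capCos
  unfold capDefect
  fun_prop

theorem continuous_capVol {κ : ℝ} (hκ : 0 < κ) :
    Continuous fun q : ℝ × ℝ => capVol κ q.1 q.2 := by
  have h1 := continuous_capWidth hκ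
  have h2 := continuous_capCurv κ
  unfold capVol
  fun_prop

/-- Near a cap, caps of the same volume form a differentiable family parametrised by the sine of
the contact angle. -/
theorem exists_capVol_implicit {κ : ℝ} (hκ : 0 < κ) (m : ℝ) {s : ℝ} (h0 : 0 < s) (h1 : s < 1) :
    ∃ ψ : ℝ → ℝ, (∀ᶠ x in 𝓝 s, capVol κ (ψ x) x = capVol κ m s) ∧ DifferentiableAt ℝ ψ s := by
  have hT := (ContinuousLinearMap.toSpanSingletonCLE (𝕜 := ℝ) (E := ℝ)).continuous
  have hW : Continuous fun q : ℝ × ℝ => capWidth κ q.2 q.1 :=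
    (continuous_capWidth hκ).comp continuous_swap
  have hD : Continuous fun q : ℝ × ℝ => capDefect κ 3 q.2 q.1 :=
    (continuous_capDefect hκ 3).comp continuous_swap
  have hC : Continuous fun q : ℝ × ℝ => capCurv κ q.2 q.1 :=
    (continuous_capCurv κ).comp continuous_swap
  have hp := capCurv_pos hκ m s
  have hc := capCos_pos h0.le h1
  have hI := capDefect_pos hκ m h0 h1
  have hcos := continuous_capCos
  have ha : -(κ / capCurv κ m s * (Real.exp m * capDefect κ 3 m s)) ≠ 0 := by
    have : 0 < κ / capCurv κ m s * (Real.exp m * capDefect κ 3 m s) := by positivity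
    linarith
  have hnear : ∀ᶠ q : ℝ × ℝ in 𝓝 (s, m), 0 < q.1 ∧ q.1 < 1 :=
    (continuous_fst.tendsto (s, m)).eventually (Ioo_mem_nhds h0 h1)
  have df1 : ∀ᶠ q : ℝ × ℝ in 𝓝 (s, m), HasFDerivAt (fun x => capVol κ q.2 x)
      (ContinuousLinearMap.toSpanSingleton ℝ
        (κ / capCurv κ q.2 q.1 * (capWidth κ q.2 q.1 * (q.1 / capCos q.1)))) q.1 :=
    hnear.mono fun q hq => (hasDerivAt_capVol_right hκ q.2 hq.1.le hq.2).hasFDerivAt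
  have df2 : ∀ᶠ q : ℝ × ℝ in 𝓝 (s, m), HasFDerivAt (fun x => capVol κ x q.1)
      (ContinuousLinearMap.toSpanSingleton ℝ
        (-(κ / capCurv κ q.2 q.1 * (Real.exp q.2 * capDefect κ 3 q.2 q.1)))) q.2 :=
    hnear.mono fun q hq => (hasDerivAt_capVol_left hκ q.2 hq.1.le hq.2).hasFDerivAt
  have cf1 : ContinuousAt (fun q : ℝ × ℝ => ContinuousLinearMap.toSpanSingleton ℝ
        (κ / capCurv κ q.2 q.1 * (capWidth κ q.2 q.1 * (q.1 / capCos q.1)))) (s, m) := by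
    refine hT.continuousAt.comp ?_
    exact (continuousAt_const.div hC.continuousAt hp.ne').mul
      (hW.continuousAt.mul (continuousAt_fst.div (hcos.comp continuous_fst).continuousAt hc.ne'))
  have cf2 : ContinuousAt (fun q : ℝ × ℝ => ContinuousLinearMap.toSpanSingleton ℝ
        (-(κ / capCurv κ q.2 q.1 * (Real.exp q.2 * capDefect κ 3 q.2 q.1)))) (s, m) := by
    refine hT.continuousAt.comp ?_
    exact ((continuousAt_const.div hC.continuousAt hp.ne').mul
      ((Real.continuous_exp.comp continuous_snd).continuousAt.mul hD.continuousAt)).neg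
  have hinv : (ContinuousLinearMap.toSpanSingleton ℝ
      (-(κ / capCurv κ m s * (Real.exp m * capDefect κ 3 m s)))).IsInvertible :=
    ⟨ContinuousLinearEquiv.unitsEquivAut ℝ (Units.mk0 _ ha), by ext; simp⟩
  let f : ℝ → ℝ → ℝ := fun x y => capVol κ y x
  let f₁ : ℝ → ℝ → ℝ →L[ℝ] ℝ := fun x y => ContinuousLinearMap.toSpanSingleton ℝ
        (κ / capCurv κ y x * (capWidth κ y x * (x / capCos x)))
  let f₂ : ℝ → ℝ → ℝ →L[ℝ] ℝ := fun x y => ContinuousLinearMap.toSpanSingleton ℝ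
        (-(κ / capCurv κ y x * (Real.exp y * capDefect κ 3 y x)))
  refine ⟨implicitFunctionOfBivariate (𝕜 := ℝ) (u := (s, m)) (f := f) (f₁ := f₁) (f₂ := f₂)
    df1 df2 cf1 cf2 hinv, ?_, ?_⟩
  · exact eventually_apply_implicitFunctionOfBivariate (f := f) (f₁ := f₁) (f₂ := f₂)
      df1 df2 cf1 cf2 hinv
  · exact (hasStrictFDerivAt_implicitFunctionOfBivariate (f := f) (f₁ := f₁) (f₂ := f₂)
      df1 df2 cf1 cf2 hinv).hasFDerivAt.differentiableAt

/-- Two caps of the same volume are joined by a differentiable family of such caps. -/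
theorem exists_cap_family {κ v : ℝ} (hκ : 0 < κ) {m₁ m₂ s₁ s₂ : ℝ} (h2 : 0 < s₂) (h21 : s₂ < s₁)
    (h1 : s₁ < 1) (hv1 : capVol κ m₁ s₁ = v) (hv2 : capVol κ m₂ s₂ = v) :
    ∃ K : ℝ → ℝ, K s₁ = m₁ ∧ K s₂ = m₂ ∧ (∀ s ∈ Icc s₂ s₁, capVol κ (K s) s = v) ∧
      DifferentiableOn ℝ K (Icc s₂ s₁) := by
  have hex : ∀ s, ∃ m, s ∈ Icc s₂ s₁ → capVol κ m s = v := by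
    intro s
    by_cases hs : s ∈ Icc s₂ s₁
    · have hc : Continuous fun m => capVol κ m s :=
        (continuous_capVol hκ).comp (Continuous.prodMk_left s)
      -- The volume increases with `s`, so at an intermediate `s` the parameter `m₁` gives too
      -- little and `m₂` too much.
      obtain ⟨m, hm⟩ := mem_range_of_exists_le_of_exists_ge hc
        ⟨m₁, (monotoneOn_capVol hκ m₁ ⟨h2.le.trans hs.1, hs.2.trans_lt h1⟩
          ⟨(h2.trans h21).le, h1⟩ hs.2).trans hv1.le⟩
        ⟨m₂, hv2.ge.trans (monotoneOn_capVol hκ m₂ ⟨h2.le, h21.trans h1⟩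
          ⟨h2.le.trans hs.1, hs.2.trans_lt h1⟩ hs.1)⟩
      exact ⟨m, fun _ => hm⟩
    · exact ⟨0, fun h => absurd h hs⟩
  choose K hK using hex
  have huniq : ∀ s ∈ Icc s₂ s₁, ∀ m, capVol κ m s = v → m = K s := fun s hs m hm =>
    (strictAnti_capVol hκ (h2.trans_le hs.1) (hs.2.trans_lt h1)).injective (hm.trans (hK s hs).symm)
  refine ⟨K, (huniq _ ⟨h21.le, le_rfl⟩ _ hv1).symm, (huniq _ ⟨le_rfl, h21.le⟩ _ hv2).symm,
    fun s hs => hK s hs, fun s hs => ?_⟩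
  -- `K` was merely chosen; uniqueness of `m` identifies it near `s` with the implicit function,
  -- which is differentiable.
  obtain ⟨ψ, hψ, hd⟩ := exists_capVol_implicit hκ (K s) (h2.trans_le hs.1) (hs.2.trans_lt h1)
  refine hd.differentiableWithinAt.congr_of_eventuallyEq_of_mem ?_ hs
  filter_upwards [self_mem_nhdsWithin, nhdsWithin_le_nhds hψ] with x hx hx2
  exact (huniq x hx _ (hx2.trans (hK s hs))).symm

/-! ### Lipschitz dependence of the contact cosine on the width -/

/-- Integrated form of dc / d(log r) ≤ 96 along the family joining the caps. The logarithm is used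
because the final bound then needs control of the width at the two ends only. -/
theorem capCos_sub_le_log {κ v : ℝ} (hκ : 0 < κ) {m₁ m₂ s₁ s₂ : ℝ} (h2 : 0 < s₂) (h21 : s₂ < s₁)
    (h1 : s₁ < 1) (hv1 : capVol κ m₁ s₁ = v) (hv2 : capVol κ m₂ s₂ = v) :
    capCos s₂ - capCos s₁ ≤
      96 * (Real.log (capWidth κ m₂ s₂) - Real.log (capWidth κ m₁ s₁)) := by
  obtain ⟨K, rfl, rfl, hv, hd⟩ := exists_cap_family hκ h2 h21 h1 hv1 hv2
  set W : ℝ → ℝ := fun s => 96 * Real.log (capWidth κ (K s) s) - capCos s with hW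
  have key : ∀ s ∈ Icc s₂ s₁, ∃ W', HasDerivWithinAt W W' (Icc s₂ s₁) s ∧ W' ≤ 0 := by
    intro s hs
    have hs0 : 0 < s := h2.trans_le hs.1
    have hs1 : s < 1 := hs.2.trans_lt h1
    obtain ⟨-, r', hr', he⟩ := cap_path hκ (uniqueDiffOn_Icc h21 s hs) hs
      (hd s hs).hasDerivWithinAt (hasDerivWithinAt_id s _) hs0 hs1 hv
    simp only [id] at hr' he
    have hrp := capWidth_pos hκ (K s) hs0
    refine ⟨_, ((hr'.log hrp.ne').const_mul 96).sub
      (hasDerivAt_capCos hs0.le hs1).hasDerivWithinAt, ?_⟩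
    have hgap := capInt_mul_defect_gap hκ (K s) hs0 hs1
    have hIJ := capDefect_le hκ (K s) hs0.le
    have hI := capDefect_pos hκ (K s) hs0 hs1
    have hJ := capInt_one_pos hκ 3 (K s) hs0
    have hL := capCurv_pos hκ (K s) s
    have hc := capCos_pos hs0.le hs1
    set I := capDefect κ 3 (K s) s
    set J := capInt κ (fun _ => 1) 3 (K s) s
    set L := capCurv κ (K s) s
    set c := capCos s
    set R := capWidth κ (K s) s
    have hIJ' : I ≤ J := by nlinarith
    have h3 : 2 * I * c * L * r' ≤ -(J * (R * s * L)) / 48 := by linarith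
    have h4 : J * (R * s * L) ≥ I * (R * s * L) := by gcongr
    have h5 : (I * L) * (96 * c * r') ≤ (I * L) * (-(R * s)) := by nlinarith
    have h6 : 96 * c * r' ≤ -(R * s) := le_of_mul_le_mul_left h5 (by positivity)
    have h7 : 96 * (r' / R) - -(s / c) = (96 * c * r' + R * s) / (R * c) := by
      field_simp
      ring
    rw [h7]
    apply div_nonpos_of_nonpos_of_nonneg (by linarith) (by positivity)
  have hanti : AntitoneOn W (Icc s₂ s₁) := by
    apply antitoneOn_of_deriv_nonpos (convex_Icc _ _)
    · intro s hs
      obtain ⟨W', h, -⟩ := key s hs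
      exact h.continuousWithinAt
    · intro s hs
      obtain ⟨W', h, -⟩ := key s (interior_subset hs)
      exact (h.mono interior_subset).differentiableWithinAt
    · intro s hs
      obtain ⟨W', h, h'⟩ := key s (interior_subset hs)
      rwa [(h.hasDerivAt (mem_interior_iff_mem_nhds.1 hs)).deriv]
  have := hanti ⟨le_rfl, h21.le⟩ ⟨h21.le, le_rfl⟩ h21.le
  simp only [hW] at this
  linarith

/-- `r` and `c` are the half-width and the cosine of the contact angle of the cap with parameters
`m`, `s`, whose volume is `2 * v / κ`. -/
structure IsCap (κ v m s r c : ℝ) : Prop where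
  pos : 0 < s
  lt_one : s < 1
  cos : c = capCos s
  width : r = capWidth κ m s
  vol : capVol κ m s = v

theorem log_sub_log_le {x y M : ℝ} (hx : 0 < x) (hy : 0 < y) (hM : 1 / x ≤ M)
    (h : 0 ≤ Real.log y - Real.log x) : Real.log y - Real.log x ≤ M * |y - x| := by
  rw [← Real.log_div hy.ne' hx.ne'] at *
  have h1 := Real.log_le_sub_one_of_pos (div_pos hy hx)
  have h2 : y / x - 1 = 1 / x * (y - x) := by field_simp
  have h3 : 0 ≤ y - x := by
    have : 0 ≤ y / x - 1 := h.trans h1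
    rw [h2] at this
    exact nonneg_of_mul_nonneg_right this (by positivity)
  rw [abs_of_nonneg h3]
  calc _ ≤ 1 / x * (y - x) := h2 ▸ h1
    _ ≤ _ := by gcongr

/-- The cosine of the contact angle is a Lipschitz function of the half-width. -/
theorem IsCap.abs_sub_le {κ v : ℝ} (hκ : 0 < κ) {m₁ s₁ r₁ c₁ m₂ s₂ r₂ c₂ M : ℝ}
    (h₁ : IsCap κ v m₁ s₁ r₁ c₁) (h₂ : IsCap κ v m₂ s₂ r₂ c₂) (hM₁ : 1 / r₁ ≤ M)
    (hM₂ : 1 / r₂ ≤ M) : |c₂ - c₁| ≤ 96 * M * |r₂ - r₁| := by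
  obtain ⟨hp1, hl1, rfl, rfl, hv1⟩ := h₁
  obtain ⟨hp2, hl2, rfl, rfl, hv2⟩ := h₂
  have hr1 := capWidth_pos hκ m₁ hp1
  have hr2 := capWidth_pos hκ m₂ hp2
  have hM : 0 ≤ M := le_trans (by positivity) hM₁
  rcases lt_trichotomy s₂ s₁ with h | h | h
  · have h3 := capCos_sub_le_log hκ hp2 h hl1 hv1 hv2
    have h4 := capCos_anti hp2.le h.le
    have h5 := log_sub_log_le hr1 hr2 hM₁ (by linarith)
    rw [abs_of_nonneg (by linarith)]
    linarith
  · subst h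
    have := (strictAnti_capVol hκ hp1 hl1).injective (hv1.trans hv2.symm)
    simp
    positivity
  · have h3 := capCos_sub_le_log hκ hp1 h hl2 hv2 hv1
    have h4 := capCos_anti hp1.le h.le
    have h5 := log_sub_log_le hr2 hr1 hM₂ (by linarith)
    rw [abs_sub_comm, abs_sub_comm (capWidth κ m₂ s₂), abs_of_nonneg (by linarith)]
    linarith

/-! ### From quasi-static profiles to caps -/

/-- The sine of the inclination angle of the graph of `u` over `[a, b]`. -/
noncomputable def sinSlope (a b : ℝ) (u : ℝ → ℝ) (x : ℝ) : ℝ :=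
  derivWithin u (Icc a b) x / √(1 + derivWithin u (Icc a b) x ^ 2)

section Profile

variable {κ V a b : ℝ} {u : ℝ → ℝ} {lam : ℝ}

theorem sinSlope_sq (a b : ℝ) (u : ℝ → ℝ) (x : ℝ) :
    1 - sinSlope a b u x ^ 2 = 1 / (1 + derivWithin u (Icc a b) x ^ 2) := by
  unfold sinSlope
  have : 0 < 1 + derivWithin u (Icc a b) x ^ 2 := by positivity
  rw [div_pow, Real.sq_sqrt this.le]
  field_simp
  ring

theorem sinSlope_sq_lt (a b : ℝ) (u : ℝ → ℝ) (x : ℝ) : sinSlope a b u x ^ 2 < 1 := by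
  have h := sinSlope_sq a b u x
  have : 0 < 1 / (1 + derivWithin u (Icc a b) x ^ 2) := by positivity
  linarith

theorem capCos_sinSlope (a b : ℝ) (u : ℝ → ℝ) (x : ℝ) :
    capCos (sinSlope a b u x) = 1 / √(1 + derivWithin u (Icc a b) x ^ 2) := by
  rw [capCos, sinSlope_sq, Real.sqrt_div zero_le_one, Real.sqrt_one]

theorem sinSlope_eq_mul (a b : ℝ) (u : ℝ → ℝ) (x : ℝ) :
    sinSlope a b u x = derivWithin u (Icc a b) x * capCos (sinSlope a b u x) := by
  rw [capCos_sinSlope, sinSlope, mul_one_div]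

theorem capCos_sinSlope_pos (a b : ℝ) (u : ℝ → ℝ) (x : ℝ) : 0 < capCos (sinSlope a b u x) := by
  rw [capCos_sinSlope]; positivity

theorem capCos_sinSlope_sq (a b : ℝ) (u : ℝ → ℝ) (x : ℝ) :
    capCos (sinSlope a b u x) ^ 2 = 1 - sinSlope a b u x ^ 2 :=
  Real.sq_sqrt (by have := sinSlope_sq_lt a b u x; linarith)

theorem hasDerivAt_profile (h : IsQuasiStaticProfile κ V a b u lam) {x : ℝ} (hx : x ∈ Ioo a b) :
    HasDerivAt u (derivWithin u (Icc a b) x) x :=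
  ((h.smooth.differentiableOn two_ne_zero x (Ioo_subset_Icc_self hx)).hasDerivWithinAt).hasDerivAt
    (Icc_mem_nhds hx.1 hx.2)

theorem contDiffOn_derivWithin (h : IsQuasiStaticProfile κ V a b u lam) :
    ContDiffOn ℝ 1 (derivWithin u (Icc a b)) (Icc a b) :=
  h.smooth.derivWithin (uniqueDiffOn_Icc h.lt) (by norm_num)

theorem continuousOn_sinSlope (h : IsQuasiStaticProfile κ V a b u lam) :
    ContinuousOn (sinSlope a b u) (Icc a b) := by
  have := (contDiffOn_derivWithin h).continuousOn
  unfold sinSlope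
  refine this.div (by fun_prop) fun x _ => ?_
  positivity

theorem hasDerivAt_sinSlope (h : IsQuasiStaticProfile κ V a b u lam) {x : ℝ} (hx : x ∈ Ioo a b) :
    HasDerivAt (sinSlope a b u) (κ * u x - lam) x := by
  have hd : DifferentiableAt ℝ (derivWithin u (Icc a b)) x :=
    ((contDiffOn_derivWithin h).differentiableOn one_ne_zero x
      (Ioo_subset_Icc_self hx)).differentiableAt (Icc_mem_nhds hx.1 hx.2)
  have hw : DifferentiableAt ℝ (sinSlope a b u) x := by
    unfold sinSlope
    refine hd.div (((hd.fun_pow 2).const_add 1).sqrt ?_) ?_ <;> positivity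
  have he : sinSlope a b u =ᶠ[𝓝 x] fun y => deriv u y / √(1 + deriv u y ^ 2) := by
    filter_upwards [Ioo_mem_nhds hx.1 hx.2] with y hy
    rw [(hasDerivAt_profile h hy).deriv, sinSlope]
  have h2 := h.equation x hx
  rw [← he.deriv_eq] at h2
  refine hw.hasDerivAt.congr_deriv ?_
  linarith

theorem constant_of_hasDerivAt_zero {f : ℝ → ℝ} (hf : ContinuousOn f (Icc a b))
    (hd : ∀ x ∈ Ioo a b, HasDerivAt f 0 x) {x : ℝ} (hx : x ∈ Icc a b) : f x = f a := by
  rcases hx.1.eq_or_lt with rfl | hax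
  · rfl
  · obtain ⟨ξ, hξ, he⟩ := exists_hasDerivAt_eq_slope f (fun _ => 0) hax
      (hf.mono (Icc_subset_Icc_right hx.2)) fun y hy => hd y ⟨hy.1, hy.2.trans_le hx.2⟩
    rw [eq_div_iff (by linarith)] at he
    linarith

/-- The first integral of the capillary equation. -/
theorem capCos_sinSlope_eq (h : IsQuasiStaticProfile κ V a b u lam) {x : ℝ} (hx : x ∈ Icc a b) :
    capCos (sinSlope a b u x) = capCos (sinSlope a b u a) + lam * u x - κ / 2 * u x ^ 2 := by
  have hc := h.smooth.continuousOn
  have hw := continuous_capCos.comp_continuousOn (continuousOn_sinSlope h)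
  have key := constant_of_hasDerivAt_zero
    (f := fun x => capCos (sinSlope a b u x) - lam * u x + κ / 2 * u x ^ 2) (a := a) (b := b)
    ((hw.sub (continuousOn_const.mul hc)).add (continuousOn_const.mul (hc.pow 2)))
    (fun x hx => by
      have h1 := (hasDerivAt_capCos_of_sq_lt (sinSlope_sq_lt a b u x)).comp x
        (hasDerivAt_sinSlope h hx)
      have h2 := hasDerivAt_profile h hx
      refine ((h1.sub (h2.const_mul lam)).add ((h2.pow 2).const_mul (κ / 2))).congr_deriv ?_
      have h3 : sinSlope a b u x / capCos (sinSlope a b u x) = derivWithin u (Icc a b) x := by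
        rw [div_eq_iff (capCos_sinSlope_pos a b u x).ne']
        exact sinSlope_eq_mul a b u x
      rw [h3]
      ring) hx
  simp only [h.left] at key
  linarith

theorem cosLeft_eq (a b : ℝ) (u : ℝ → ℝ) : cosLeft a b u = capCos (sinSlope a b u a) :=
  (capCos_sinSlope a b u a).symm

theorem cosRight_eq_cosLeft (h : IsQuasiStaticProfile κ V a b u lam) :
    cosRight a b u = cosLeft a b u := by
  have := capCos_sinSlope_eq h (right_mem_Icc.2 h.lt.le)
  rw [h.right] at this
  rw [cosLeft_eq, cosRight, ← capCos_sinSlope, this]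
  ring

theorem continuousOn_profile_uIcc (h : IsQuasiStaticProfile κ V a b u lam) :
    ContinuousOn u (uIcc a b) := by
  rw [uIcc_of_le h.lt.le]; exact h.smooth.continuousOn

theorem sinSlope_sub (h : IsQuasiStaticProfile κ V a b u lam) :
    sinSlope a b u b - sinSlope a b u a = κ * V - lam * (b - a) := by
  have hi : IntervalIntegrable u volume a b := (continuousOn_profile_uIcc h).intervalIntegrable
  have := intervalIntegral.integral_eq_sub_of_hasDerivAt_of_le h.lt.le (continuousOn_sinSlope h)
    (fun x hx => hasDerivAt_sinSlope h hx) ((hi.const_mul κ).sub intervalIntegrable_const)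
  rw [← this, intervalIntegral.integral_sub (hi.const_mul κ) intervalIntegrable_const,
    intervalIntegral.integral_const_mul, h.volume]
  simp [mul_comm]

/-- Testing the equation with `u` gives λV = ∫ (κu² + u_x sin), and both terms are nonnegative. -/
theorem lam_nonneg (hκ : 0 < κ) (hV : 0 < V) (h : IsQuasiStaticProfile κ V a b u lam) :
    0 ≤ lam := by
  have hu := h.smooth.continuousOn
  have hw := continuousOn_sinSlope h
  have hd := (contDiffOn_derivWithin h).continuousOn
  have hi : IntervalIntegrable u volume a b := (continuousOn_profile_uIcc h).intervalIntegrable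
  have hi2 : IntervalIntegrable (fun x => κ * u x ^ 2 + sinSlope a b u x *
      derivWithin u (Icc a b) x) volume a b := by
    apply ContinuousOn.intervalIntegrable
    rw [uIcc_of_le h.lt.le]
    exact (continuousOn_const.mul (hu.pow 2)).add (hw.mul hd)
  have key := intervalIntegral.integral_eq_sub_of_hasDerivAt_of_le (a := a) (b := b)
    (f := fun x => sinSlope a b u x * u x)
    (f' := fun x => (κ * u x ^ 2 + sinSlope a b u x * derivWithin u (Icc a b) x) - lam * u x)
    h.lt.le (hw.mul hu)
    (fun x hx => ((hasDerivAt_sinSlope h hx).mul (hasDerivAt_profile h hx)).congr_deriv (by ring))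
    (hi2.sub (hi.const_mul lam))
  rw [intervalIntegral.integral_sub hi2 (hi.const_mul lam), intervalIntegral.integral_const_mul,
    h.volume, h.left, h.right] at key
  have hnn : 0 ≤ ∫ x in a..b, (κ * u x ^ 2 + sinSlope a b u x * derivWithin u (Icc a b) x) := by
    refine intervalIntegral.integral_nonneg h.lt.le fun x _ => ?_
    have h1 := sinSlope_eq_mul a b u x
    have h2 := capCos_sinSlope_pos a b u x
    have h3 : sinSlope a b u x * derivWithin u (Icc a b) x =
      derivWithin u (Icc a b) x ^ 2 * capCos (sinSlope a b u x) := by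
      conv_lhs => rw [h1]
      ring
    rw [h3]
    positivity
  by_contra hl
  push Not at hl
  nlinarith

theorem sq_sub_eq (h : IsQuasiStaticProfile κ V a b u lam) {x : ℝ} (hx : x ∈ Icc a b) :
    (lam - κ * u x) ^ 2 = lam ^ 2 - 2 * κ * (1 - capCos (sinSlope a b u a)) +
      2 * κ * (1 - capCos (sinSlope a b u x)) := by
  rw [capCos_sinSlope_eq h hx]; ring

theorem sinSlope_eq_zero {x : ℝ} (hx : derivWithin u (Icc a b) x = 0) : sinSlope a b u x = 0 := by
  simp [sinSlope, hx]

/-- The quantity equals (λ − κu)² at a critical point, so it is nonnegative. Were it zero, the sine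
w would satisfy |w'| ≤ √(2κ)|w| with a zero at that point; Grönwall forces w = 0 up to `b`, then w =
0 at `a` and λ = 0, contradicting V > 0. -/
theorem apex_sq_pos (hκ : 0 < κ) (hV : 0 < V) (h : IsQuasiStaticProfile κ V a b u lam) :
    0 < lam ^ 2 - 2 * κ * (1 - capCos (sinSlope a b u a)) := by
  obtain ⟨x₀, hx₀, hd₀⟩ := exists_hasDerivAt_eq_zero h.lt h.smooth.continuousOn
    (h.left.trans h.right.symm) fun x hx => hasDerivAt_profile h hx
  have hw₀ := sinSlope_eq_zero hd₀
  have he := sq_sub_eq h (Ioo_subset_Icc_self hx₀)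
  rw [hw₀, capCos_zero] at he
  by_contra hneg
  set k := lam ^ 2 - 2 * κ * (1 - capCos (sinSlope a b u a)) with hk
  have hk0 : k = 0 := by nlinarith [sq_nonneg (lam - κ * u x₀)]
  set w := sinSlope a b u with hw
  set B := √(2 * κ) with hB
  have hB2 : B ^ 2 = 2 * κ := Real.sq_sqrt (by positivity)
  have hB0 : 0 ≤ B := Real.sqrt_nonneg _
  have hanti : AntitoneOn (fun x => w x ^ 2 * Real.exp (-(2 * B * x))) (Icc x₀ b) := by
    have hd : ∀ x ∈ Ioo x₀ b, HasDerivAt (fun x => w x ^ 2 * Real.exp (-(2 * B * x)))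
        ((2 * w x * (κ * u x - lam) - 2 * B * w x ^ 2) * Real.exp (-(2 * B * x))) x := by
      intro x hx
      have h1 := hasDerivAt_sinSlope h ⟨hx₀.1.trans hx.1, hx.2⟩
      have h2 : HasDerivAt (fun x => -(2 * B * x)) (-(2 * B)) x := by
        simpa using ((hasDerivAt_id x).const_mul (2 * B)).fun_neg
      refine ((h1.pow 2).mul h2.exp).congr_deriv ?_
      simp only [Pi.pow_apply, ← hw]
      push_cast
      ring
    apply antitoneOn_of_deriv_nonpos (convex_Icc _ _)
    · have := (continuousOn_sinSlope h).mono (Icc_subset_Icc_left hx₀.1.le)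
      exact (this.pow 2).mul (by fun_prop)
    · rw [interior_Icc]
      exact fun x hx => (hd x hx).differentiableAt.differentiableWithinAt
    · rw [interior_Icc]
      intro x hx
      rw [(hd x hx).deriv]
      apply mul_nonpos_of_nonpos_of_nonneg _ (Real.exp_pos _).le
      have hxI : x ∈ Icc a b := ⟨(hx₀.1.trans hx.1).le, hx.2.le⟩
      have h3 := sq_sub_eq h hxI
      rw [← hk, hk0, zero_add] at h3
      have h4 := capCos_sinSlope_sq a b u x
      have h5 := capCos_sinSlope_pos a b u x
      have h6 := capCos_le_one (sinSlope a b u x)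
      have h7 : (lam - κ * u x) ^ 2 ≤ (B * w x) ^ 2 := by
        rw [h3, mul_pow, hB2, hw]
        apply mul_le_mul_of_nonneg_left _ (by positivity)
        nlinarith
      have h9 := sq_le_sq.1 h7
      rw [abs_mul, abs_of_nonneg hB0] at h9
      have h10 : w x * (κ * u x - lam) ≤ |w x| * |lam - κ * u x| := by
        rw [abs_sub_comm, ← abs_mul]; exact le_abs_self _
      have h11 : |w x| * |lam - κ * u x| ≤ |w x| * (B * |w x|) := by gcongr
      have h12 : |w x| * (B * |w x|) = B * w x ^ 2 := by rw [← sq_abs (w x)]; ring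
      linarith
  have hb := hanti ⟨le_rfl, hx₀.2.le⟩ ⟨hx₀.2.le, le_rfl⟩ hx₀.2.le
  simp only [hw₀] at hb
  have hwb : w b = 0 := by
    have h1 := Real.exp_pos (-(2 * B * b))
    have h2 : w b ^ 2 ≤ 0 := by
      by_contra h3
      push Not at h3
      have := mul_pos h3 h1
      simp at hb
      linarith
    nlinarith
  have hca := capCos_sinSlope_eq h (right_mem_Icc.2 h.lt.le)
  rw [← hw, hwb, h.right, capCos_zero] at hca
  have hca1 : capCos (w a) = 1 := by linarith
  have hwa : w a = 0 := by
    have := capCos_sinSlope_sq a b u a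
    rw [← hw, hca1] at this
    nlinarith
  have hlam : lam = 0 := by
    rw [hca1] at hk
    nlinarith
  have := sinSlope_sub h
  rw [← hw, hwa, hwb, hlam] at this
  have := mul_pos hκ hV
  linarith

/-- The square is bounded below by the positive apex value, so λ − κu never vanishes; at `a` it is λ
≥ 0, and continuity preserves the sign. -/
theorem lam_sub_pos (hκ : 0 < κ) (hV : 0 < V) (h : IsQuasiStaticProfile κ V a b u lam) {x : ℝ}
    (hx : x ∈ Icc a b) : 0 < lam - κ * u x := by
  have hk := apex_sq_pos hκ hV h
  have hne : ∀ y ∈ Icc a b, lam - κ * u y ≠ 0 := by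
    intro y hy h0
    have h1 := sq_sub_eq h hy
    rw [h0] at h1
    have h2 := capCos_le_one (sinSlope a b u y)
    nlinarith
  by_contra hneg
  push Not at hneg
  have hcont : ContinuousOn (fun y => lam - κ * u y) (Icc a x) :=
    (continuousOn_const.sub (continuousOn_const.mul h.smooth.continuousOn)).mono
      (Icc_subset_Icc_right hx.2)
  have h0 : (0 : ℝ) ∈ Icc (lam - κ * u x) (lam - κ * u a) :=
    ⟨hneg, by rw [h.left, mul_zero, sub_zero]; exact lam_nonneg hκ hV h⟩
  obtain ⟨y, hy, hy0⟩ := intermediate_value_Icc' hx.1 hcont h0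
  exact hne y ⟨hy.1, hy.2.trans hx.2⟩ hy0

theorem strictAntiOn_sinSlope (hκ : 0 < κ) (hV : 0 < V)
    (h : IsQuasiStaticProfile κ V a b u lam) : StrictAntiOn (sinSlope a b u) (Icc a b) := by
  apply strictAntiOn_of_deriv_neg (convex_Icc _ _) (continuousOn_sinSlope h)
  rw [interior_Icc]
  intro x hx
  rw [(hasDerivAt_sinSlope h hx).deriv]
  have := lam_sub_pos hκ hV h (Ioo_subset_Icc_self hx)
  linarith

/-- The first integral gives equal cosines at the two ends, so the sines agree up to sign; strict
monotonicity excludes equality. -/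
theorem sinSlope_right (hκ : 0 < κ) (hV : 0 < V) (h : IsQuasiStaticProfile κ V a b u lam) :
    sinSlope a b u b = -sinSlope a b u a ∧ 0 < sinSlope a b u a := by
  have h1 := strictAntiOn_sinSlope hκ hV h (left_mem_Icc.2 h.lt.le) (right_mem_Icc.2 h.lt.le) h.lt
  have h2 := capCos_sinSlope_eq h (right_mem_Icc.2 h.lt.le)
  rw [h.right] at h2
  have h3 := capCos_sinSlope_sq a b u a
  have h4 := capCos_sinSlope_sq a b u b
  rw [h2] at h4
  have h5 : (sinSlope a b u b - sinSlope a b u a) * (sinSlope a b u b + sinSlope a b u a) = 0 := by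
    nlinarith
  rcases mul_eq_zero.1 h5 with h6 | h6
  · linarith
  · exact ⟨by linarith, by linarith⟩

/-- A quasi-static profile is a cap. -/
theorem exists_isCap (hκ : 0 < κ) (hV : 0 < V) (h : IsQuasiStaticProfile κ V a b u lam) :
    ∃ m s, IsCap κ (κ * V / 2) m s ((b - a) / 2) (cosLeft a b u) ∧ lam = capCurv κ m s := by
  obtain ⟨hwb, hwa⟩ := sinSlope_right hκ hV h
  have hk := apex_sq_pos hκ hV h
  set m := Real.log (lam ^ 2 - 2 * κ * (1 - capCos (sinSlope a b u a))) with hm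
  have hp : ∀ x ∈ Icc a b, capCurv κ m (sinSlope a b u x) = lam - κ * u x := by
    intro x hx
    rw [capCurv, hm, Real.exp_log hk, ← sq_sub_eq h hx, Real.sqrt_sq (lam_sub_pos hκ hV h hx).le]
  have hpa := hp a (left_mem_Icc.2 h.lt.le)
  rw [h.left, mul_zero, sub_zero] at hpa
  have hΨ : Continuous fun y => capInt κ (fun _ => 1) 1 m y :=
    (continuous_capInt hκ continuous_const 1).comp (Continuous.prodMk_right m)
  -- Since dy/dx = −`capCurv`, position plus the primitive of 1/`capCurv` at the sine is constant;
  -- comparing the ends gives the width.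
  have key := constant_of_hasDerivAt_zero (a := a) (b := b)
    (f := fun x => capInt κ (fun _ => 1) 1 m (sinSlope a b u x) + x)
    ((hΨ.comp_continuousOn (continuousOn_sinSlope h)).add continuousOn_id)
    (fun x hx => by
      refine (((hasDerivAt_capInt_right hκ continuous_const 1 m _).comp x
        (hasDerivAt_sinSlope h hx)).add (hasDerivAt_id x)).congr_deriv ?_
      have hx' := Ioo_subset_Icc_self hx
      rw [hp x hx']
      have := lam_sub_pos hκ hV h hx'
      field_simp
      ring) (right_mem_Icc.2 h.lt.le)
  have hodd : capInt κ (fun _ => 1) 1 m (-sinSlope a b u a) = -capWidth κ m (sinSlope a b u a) := by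
    unfold capWidth capInt
    have := intervalIntegral.integral_comp_neg (a := 0) (b := sinSlope a b u a)
      fun y => 1 / capCurv κ m y ^ 1
    simp only [capCurv_neg, neg_zero] at this
    rw [this, ← intervalIntegral.integral_symm]
  have hwidth : (b - a) / 2 = capWidth κ m (sinSlope a b u a) := by
    simp only [hwb, hodd] at key
    change _ = capWidth κ m (sinSlope a b u a) + a at key
    linarith
  refine ⟨m, sinSlope a b u a, ⟨hwa, ?_, cosLeft_eq a b u, hwidth, ?_⟩, hpa.symm⟩
  · have := sinSlope_sq_lt a b u a
    nlinarith
  -- The volume comes from the integrated equation −2s = κV − λ(b − a), without integrating `u`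
  -- along the cap.
  · rw [capVol, ← hwidth, hpa]
    have := sinSlope_sub h
    rw [hwb] at this
    linarith

/-! ### Height bounds and uniform geometry -/

/-- Used on both sides of the apex, this puts a triangle under the graph: r u_m < V, so the
denominator in `angleSlopeBound` is positive. -/
theorem trapezoid_lt_integral {f : ℝ → ℝ} {x y : ℝ} (hxy : x < y)
    (hc : ContinuousOn f (Icc x y)) (hf : StrictConcaveOn ℝ (Icc x y) f) :
    (y - x) * (f x + f y) / 2 < ∫ z in x..y, f z := by
  have hyx : 0 < y - x := sub_pos.2 hxy
  have hi : IntervalIntegrable f volume x y := by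
    apply ContinuousOn.intervalIntegrable; rwa [uIcc_of_le hxy.le]
  have hl : Continuous fun z => f x + (f y - f x) / (y - x) * (z - x) := by fun_prop
  have hpos := intervalIntegral.intervalIntegral_pos_of_pos_on
    (f := fun z => f z - (f x + (f y - f x) / (y - x) * (z - x))) (a := x) (b := y)
    (hi.sub (hl.intervalIntegrable _ _)) (fun z hz => by
      have h1 : 0 < (y - z) / (y - x) := div_pos (sub_pos.2 hz.2) hyx
      have h2 : 0 < (z - x) / (y - x) := div_pos (sub_pos.2 hz.1) hyx
      have h3 := hf.2 (left_mem_Icc.2 hxy.le) (right_mem_Icc.2 hxy.le) hxy.ne h1 h2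
        (by field_simp; ring)
      simp only [smul_eq_mul] at h3
      have h4 : (y - z) / (y - x) * x + (z - x) / (y - x) * y = z := by field_simp; ring
      have h5 : (y - z) / (y - x) * f x + (z - x) / (y - x) * f y =
        f x + (f y - f x) / (y - x) * (z - x) := by field_simp; ring
      rw [h4, h5] at h3
      linarith) hxy
  rw [intervalIntegral.integral_sub hi (hl.intervalIntegrable _ _)] at hpos
  have h6 : ∫ z in x..y, (f x + (f y - f x) / (y - x) * (z - x)) = (y - x) * (f x + f y) / 2 := by
    rw [intervalIntegral.integral_add (by simp) (by
      apply Continuous.intervalIntegrable; fun_prop), intervalIntegral.integral_const_mul,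
      intervalIntegral.integral_sub (by simp) (by simp)]
    simp
    field_simp
    ring
  linarith

theorem strictConcaveOn_profile (hκ : 0 < κ) (hV : 0 < V)
    (h : IsQuasiStaticProfile κ V a b u lam) : StrictConcaveOn ℝ (Icc a b) u := by
  apply StrictAntiOn.strictConcaveOn_of_deriv (convex_Icc a b) h.smooth.continuousOn
  rw [interior_Icc]
  intro x hx y hy hxy
  rw [(hasDerivAt_profile h hx).deriv, (hasDerivAt_profile h hy).deriv]
  have h1 := strictAntiOn_sinSlope hκ hV h (Ioo_subset_Icc_self hx) (Ioo_subset_Icc_self hy) hxy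
  unfold sinSlope at h1
  rw [← Real.sin_arctan, ← Real.sin_arctan] at h1
  exact Real.sin_arctan_strictMono.lt_iff_lt.1 h1

/-- Elementary bounds for the height of a profile. -/
theorem maxHeight_bounds (hκ : 0 < κ) (hV : 0 < V) (h : IsQuasiStaticProfile κ V a b u lam) :
    0 < maxHeight a b u ∧ κ * maxHeight a b u ^ 2 ≤ 2 ∧ maxHeight a b u ≤ b - a ∧
      V ≤ (b - a) * maxHeight a b u ∧ (b - a) / 2 * maxHeight a b u < V := by
  have hu := h.smooth.continuousOn
  have hi : IntervalIntegrable u volume a b := (continuousOn_profile_uIcc h).intervalIntegrable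
  obtain ⟨x₁, hx₁, hmax, hle⟩ := isCompact_Icc.exists_sSup_image_eq_and_ge
    (nonempty_Icc.2 h.lt.le) hu
  have hH : maxHeight a b u = u x₁ := hmax
  rw [hH]
  have hVle : V ≤ (b - a) * u x₁ := by
    rw [← h.volume]
    have := intervalIntegral.integral_mono_on h.lt.le hi
      (intervalIntegrable_const (c := u x₁)) hle
    simpa using this
  have hab := sub_pos.2 h.lt
  have hpos : 0 < u x₁ := by
    by_contra hneg
    push Not at hneg
    nlinarith
  have hx₁' : x₁ ∈ Ioo a b := by
    refine ⟨lt_of_le_of_ne hx₁.1 ?_, lt_of_le_of_ne hx₁.2 ?_⟩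
    · rintro rfl; linarith [h.left]
    · rintro rfl; linarith [h.right]
  have hd : derivWithin u (Icc a b) x₁ = 0 := by
    refine IsLocalMax.hasDerivAt_eq_zero ?_ (hasDerivAt_profile h hx₁')
    filter_upwards [Icc_mem_nhds hx₁'.1 hx₁'.2] with y hy using hle y hy
  -- At the top, 1 − c = λH − κH²/2 with λ > κH. This yields κH² ≤ 2, and also λH/2 ≤ 1 − c ≤ s ≤
  -- λ(b − a)/2, that is H ≤ b − a.
  have h1 := capCos_sinSlope_eq h hx₁
  rw [sinSlope_eq_zero hd, capCos_zero] at h1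
  have h2 := lam_sub_pos hκ hV h hx₁
  have h3 := capCos_sinSlope_pos a b u a
  refine ⟨hpos, by nlinarith, ?_, hVle, ?_⟩
  · obtain ⟨m, s, hcap, hlam⟩ := exists_isCap hκ hV h
    have hL := capCurv_pos hκ m s
    have h4 := le_capWidth_mul hκ m hcap.pos
    rw [← hcap.width, ← hlam] at h4
    have h5 := capCos_sq hcap.pos.le hcap.lt_one.le
    have h6 := hcap.cos
    rw [cosLeft_eq] at h6
    rw [← h6] at h5
    rw [← hlam] at hL
    have h7 : 1 - capCos (sinSlope a b u a) ≤ s := by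
      have := capCos_le_one (sinSlope a b u a)
      have := hcap.pos
      nlinarith
    have h8 : lam * u x₁ ≤ lam * (b - a) := by nlinarith
    exact le_of_mul_le_mul_left h8 hL
  · have hconc := strictConcaveOn_profile hκ hV h
    have s1 : Icc a x₁ ⊆ Icc a b := Icc_subset_Icc_right hx₁.2
    have s2 : Icc x₁ b ⊆ Icc a b := Icc_subset_Icc_left hx₁.1
    have t1 := trapezoid_lt_integral hx₁'.1 (hu.mono s1) (hconc.subset s1 (convex_Icc _ _))
    have t2 := trapezoid_lt_integral hx₁'.2 (hu.mono s2) (hconc.subset s2 (convex_Icc _ _))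
    rw [h.left] at t1
    rw [h.right] at t2
    have i1 : IntervalIntegrable u volume a x₁ := by
      apply ContinuousOn.intervalIntegrable; rw [uIcc_of_le hx₁.1]; exact hu.mono s1
    have i2 : IntervalIntegrable u volume x₁ b := by
      apply ContinuousOn.intervalIntegrable; rw [uIcc_of_le hx₁.2]; exact hu.mono s2
    have := intervalIntegral.integral_add_adjacent_intervals i1 i2
    rw [h.volume] at this
    nlinarith

theorem six_div_le_angleSlopeBound (hκ : 0 < κ) (hV : 0 < V)
    (h : IsQuasiStaticProfile κ V a b u lam) :
    6 / maxHeight a b u ≤ angleSlopeBound κ V a b u := by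
  obtain ⟨h0, -, -, -, h1⟩ := maxHeight_bounds hκ hV h
  have hab := sub_pos.2 h.lt
  unfold angleSlopeBound
  set H := maxHeight a b u
  have h2 : 0 < V - (b - a) / 2 * H := by linarith
  have h3 : V - (b - a) / 2 * H ≤ V := by
    have : 0 ≤ (b - a) / 2 * H := by positivity
    linarith
  calc 6 / H = 1 / V * (6 * V / H) := by field_simp
    _ ≤ 1 / (V - (b - a) / 2 * H) * (6 * V / H) := by gcongr
    _ ≤ _ := by
      gcongr
      have : 0 < κ * H ^ 3 := by positivity
      linarith

/-- One bound on the slope of the contact angle controls the geometry of all profiles of the same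
volume. -/
theorem inv_add_sqrt_le (hκ : 0 < κ) (hV : 0 < V) {a' b' lam' Cm : ℝ} {u' : ℝ → ℝ}
    (h : IsQuasiStaticProfile κ V a b u lam) (hC : angleSlopeBound κ V a b u ≤ Cm)
    (h' : IsQuasiStaticProfile κ V a' b' u' lam') :
    1 / ((b' - a') / 2) + √(2 * κ) ≤ Cm := by
  obtain ⟨p0, p1, p2, p3, p4⟩ := maxHeight_bounds hκ hV h
  obtain ⟨q0, q1, q2, q3, q4⟩ := maxHeight_bounds hκ hV h'
  have h6 := (six_div_le_angleSlopeBound hκ hV h).trans hC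
  set H := maxHeight a b u
  set H' := maxHeight a' b' u'
  set R := (b' - a') / 2 with hR
  have hRp : 0 < R := by have := sub_pos.2 h'.lt; positivity
  -- The common volume links the two profiles: H² ≤ (b − a)H ≤ 2V ≤ 4RH' ≤ 8R².
  have e1 : H ^ 2 ≤ (3 * R) ^ 2 := by
    have h1 : H * H ≤ (b - a) * H := by gcongr
    have h2 : (b' - a') * H' ≤ (b' - a') * (b' - a') := by
      have := sub_pos.2 h'.lt
      gcongr
    have h3 : b' - a' = 2 * R := by rw [hR]; ring
    rw [h3] at h2 q3
    nlinarith
  have e2 : H ≤ 3 * R := le_of_sq_le_sq e1 (by positivity)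
  have e3 : 1 / R ≤ 3 / H := by
    rw [div_le_div_iff₀ hRp p0]; linarith
  have e4 : √(2 * κ) ≤ 3 / H := by
    apply Real.sqrt_le_iff.2
    refine ⟨by positivity, ?_⟩
    rw [div_pow, le_div_iff₀ (by positivity)]
    nlinarith
  have e5 : 6 / H = 3 / H + 3 / H := by ring
  linarith

end Profile

/-! ### Logarithmic derivatives along a family of caps -/

/-- `f` is differentiable within `S` at `t` and its logarithmic derivative is at most `β`. -/
def LogDerivBound (S : Set ℝ) (t : ℝ) (f : ℝ → ℝ) (β : ℝ) : Prop :=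
  ∃ f', HasDerivWithinAt f f' S t ∧ |f'| ≤ β * f t

theorem LogDerivBound.mul {S : Set ℝ} {t α β : ℝ} {f g : ℝ → ℝ} (hf : LogDerivBound S t f α)
    (hg : LogDerivBound S t g β) (hf0 : 0 ≤ f t) (hg0 : 0 ≤ g t) :
    LogDerivBound S t (fun τ => f τ * g τ) (α + β) := by
  obtain ⟨f', hf', hf1⟩ := hf
  obtain ⟨g', hg', hg1⟩ := hg
  refine ⟨_, hf'.mul hg', (abs_add_le _ _).trans ?_⟩
  rw [abs_mul, abs_mul, abs_of_nonneg hf0, abs_of_nonneg hg0]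
  have h1 : |f'| * g t ≤ α * f t * g t := by gcongr
  have h2 : f t * |g'| ≤ f t * (β * g t) := by gcongr
  linarith

theorem LogDerivBound.div {S : Set ℝ} {t α β : ℝ} {f g : ℝ → ℝ} (hf : LogDerivBound S t f α)
    (hg : LogDerivBound S t g β) (hf0 : 0 ≤ f t) (hg0 : 0 < g t) :
    LogDerivBound S t (fun τ => f τ / g τ) (α + β) := by
  obtain ⟨f', hf', hf1⟩ := hf
  obtain ⟨g', hg', hg1⟩ := hg
  refine ⟨_, hf'.div hg' hg0.ne', ?_⟩
  rw [abs_div, abs_of_pos (pow_pos hg0 2), div_le_iff₀ (pow_pos hg0 2)]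
  refine (abs_sub _ _).trans ?_
  rw [abs_mul, abs_mul, abs_of_nonneg hf0, abs_of_pos hg0]
  have h1 : |f'| * g t ≤ α * f t * g t := by gcongr
  have h2 : f t * |g'| ≤ f t * (β * g t) := by gcongr
  have h3 : (α + β) * (f t / g t) * g t ^ 2 = α * f t * g t + f t * (β * g t) := by
    field_simp
  linarith

/-- The derivative of the cosine of the contact angle with respect to the half-width. -/
noncomputable def capSlope (κ m s : ℝ) : ℝ :=
  2 * capDefect κ 3 m s * s * capCurv κ m s /
    (capInt κ (fun _ => 1) 3 m s * (capWidth κ m s * s * capCurv κ m s) -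
      2 * capDefect κ 3 m s * capCos s)

theorem capSlope_denom_ge {κ : ℝ} (hκ : 0 < κ) (m : ℝ) {s : ℝ} (h0 : 0 < s) (h1 : s < 1) :
    capInt κ (fun _ => 1) 3 m s * (capWidth κ m s * s * capCurv κ m s) / 48 ≤
      capInt κ (fun _ => 1) 3 m s * (capWidth κ m s * s * capCurv κ m s) -
      2 * capDefect κ 3 m s * capCos s := by
  have := capInt_mul_defect_gap hκ m h0 h1
  linarith

theorem capInt_mul_pos {κ : ℝ} (hκ : 0 < κ) (m : ℝ) {s : ℝ} (h0 : 0 < s) :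
    0 < capInt κ (fun _ => 1) 3 m s * (capWidth κ m s * s * capCurv κ m s) := by
  have hJ := capInt_one_pos hκ 3 m h0
  have hR := capWidth_pos hκ m h0
  have hL := capCurv_pos hκ m s
  positivity

theorem capSlope_nonneg {κ : ℝ} (hκ : 0 < κ) (m : ℝ) {s : ℝ} (h0 : 0 < s) (h1 : s < 1) :
    0 ≤ capSlope κ m s := by
  have h2 := capSlope_denom_ge hκ m h0 h1
  have h3 := capInt_mul_pos hκ m h0
  have hI := capDefect_pos hκ m h0 h1
  have hL := capCurv_pos hκ m s
  unfold capSlope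
  apply div_nonneg (by positivity)
  linarith

theorem capSlope_le {κ : ℝ} (hκ : 0 < κ) (m : ℝ) {s : ℝ} (h0 : 0 < s) (h1 : s < 1) :
    capSlope κ m s ≤ 96 * (1 - capCos s) / capWidth κ m s := by
  have h2 := capSlope_denom_ge hκ m h0 h1
  have h3 := capInt_mul_pos hκ m h0
  have hI := capDefect_le hκ m h0.le
  have hI0 := capDefect_pos hκ m h0 h1
  have hL := capCurv_pos hκ m s
  have hR := capWidth_pos hκ m h0
  have hJ := capInt_one_pos hκ 3 m h0
  unfold capSlope
  set I := capDefect κ 3 m s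
  set J := capInt κ (fun _ => 1) 3 m s
  set L := capCurv κ m s
  set R := capWidth κ m s
  calc _ ≤ 2 * I * s * L / (J * (R * s * L) / 48) := by gcongr
    _ = 96 * I / (J * R) := by field_simp; norm_num
    _ ≤ 96 * ((1 - capCos s) * J) / (J * R) := by gcongr
    _ = _ := by field_simp

section Path

variable {κ v M : ℝ} {m s : ℝ → ℝ} {m' s' r' t : ℝ} {S : Set ℝ}

/-- Rates of change of the parameters along a family of caps of constant volume whose contact
points move with at most unit speed. -/
theorem cap_rates (hκ : 0 < κ) (hS : UniqueDiffWithinAt ℝ S t) (ht : t ∈ S)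
    (hm : HasDerivWithinAt m m' S t) (hs : HasDerivWithinAt s s' S t) (h0 : 0 < s t)
    (h1 : s t < 1) (hv : ∀ τ ∈ S, capVol κ (m τ) (s τ) = v)
    (hr : HasDerivWithinAt (fun τ => capWidth κ (m τ) (s τ)) r' S t) (hr1 : |r'| ≤ 1)
    (hM : 1 / capWidth κ (m t) (s t) + √(2 * κ) ≤ M) :
    -(s t / capCos (s t)) * s' = capSlope κ (m t) (s t) * r' ∧
      |-(s t / capCos (s t)) * s'| ≤ 96 * M * (1 - capCos (s t)) ∧
      |s'| ≤ 96 * M * s t ∧ |m'| ≤ 192 * M ∧ |r'| ≤ M * capWidth κ (m t) (s t) := by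
  obtain ⟨hm', r'', hr'', he⟩ := cap_path hκ hS ht hm hs h0 h1 hv
  obtain rfl := hS.eq_deriv _ hr hr''
  have hden := capSlope_denom_ge hκ (m t) h0 h1
  have hden0 := capInt_mul_pos hκ (m t) h0
  have hI := capDefect_pos hκ (m t) h0 h1
  have hIJ := mul_le_two_mul_capDefect hκ (m t) h0 h1
  have hL := capCurv_pos hκ (m t) (s t)
  have hR := capWidth_pos hκ (m t) h0
  have hJ := capInt_one_pos hκ 3 (m t) h0
  have hc := capCos_pos h0.le h1
  have hc1 := capCos_lt_one h0 h1.le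
  have hcs := one_sub_capCos_le_sq h0.le h1.le
  have hE := div_le_exp_mul_capInt hκ (m t) h0.le h1
  have hsl := capSlope_le hκ (m t) h0 h1
  have hsl0 := capSlope_nonneg hκ (m t) h0 h1
  have hwl := capWidth_mul_sub_le hκ (m t) h0.le h1.le
  have hsq := Real.sqrt_nonneg (2 * κ)
  have hRM : 1 / capWidth κ (m t) (s t) ≤ M := by linarith
  have hEp := Real.exp_pos (m t)
  have hslope : -(s t / capCos (s t)) * s' = capSlope κ (m t) (s t) * r' := by
    unfold capSlope
    rw [div_mul_eq_mul_div, eq_div_iff (by linarith)]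
    field_simp
    linarith
  set I := capDefect κ 3 (m t) (s t)
  set J := capInt κ (fun _ => 1) 3 (m t) (s t)
  set L := capCurv κ (m t) (s t)
  set R := capWidth κ (m t) (s t)
  set c := capCos (s t)
  set Φ := capSlope κ (m t) (s t)
  have hb0 : |-(s t / c) * s'| ≤ 96 * (1 - c) / R := by
    rw [hslope, abs_mul, abs_of_nonneg hsl0]
    calc Φ * |r'| ≤ Φ * 1 := by gcongr
      _ ≤ _ := by linarith
  have hb : |-(s t / c) * s'| ≤ 96 * M * (1 - c) := by
    refine hb0.trans ?_
    have : 96 * (1 - c) / R = 96 * (1 / R) * (1 - c) := by ring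
    rw [this]
    have : 0 ≤ 1 - c := by linarith
    gcongr
  have hM0 : 0 ≤ M := le_trans (by positivity) hRM
  refine ⟨hslope, hb, ?_, ?_, ?_⟩
  -- The factor 1 − c kept in the bound on c' is at most s², which leaves one power of s after
  -- division.
  · have h2 : |s'| * s t = c * |-(s t / c) * s'| := by
      rw [abs_mul, abs_neg, abs_of_pos (div_pos h0 hc)]; field_simp
    have h3 : |s'| * s t ≤ 96 * M * s t * s t := by
      rw [h2]
      calc c * |-(s t / c) * s'| ≤ 1 * (96 * M * (1 - c)) := by gcongr
        _ ≤ 1 * (96 * M * s t ^ 2) := by gcongr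
        _ = _ := by ring
    exact le_of_mul_le_mul_right h3 h0
  -- The right side is at most 96(1 − c), and I ≥ (1 − c)J/2, so eᵐJ|m'| ≤ 192; finally eᵐJ ≥ s/L ≥
  -- 1/M.
  · have h2 : Real.exp (m t) * I * |m'| = R * |-(s t / c) * s'| := by
      have h := congrArg abs (show Real.exp (m t) * I * m' = -(R * (-(s t / c) * s')) by linarith)
      rwa [abs_neg, abs_mul, abs_mul R, abs_of_pos hR, abs_of_pos (mul_pos hEp hI)] at h
    have h3 : Real.exp (m t) * I * |m'| ≤ 96 * (1 - c) := by
      rw [h2]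
      calc R * |-(s t / c) * s'| ≤ R * (96 * (1 - c) / R) := by gcongr
        _ = _ := by field_simp
    have h4 : L ≤ s t * M := by
      have : L * R ≤ s t * (1 / R + √(2 * κ)) * R := by
        have : s t * (1 / R + √(2 * κ)) * R = s t + √(2 * κ) * s t * R := by field_simp
        linarith
      calc L ≤ s t * (1 / R + √(2 * κ)) := le_of_mul_le_mul_right this hR
        _ ≤ _ := by gcongr
    have h5 : 1 ≤ M * (Real.exp (m t) * J) := by
      rw [div_le_iff₀ hL] at hE
      have h6 : s t ≤ s t * (M * (Real.exp (m t) * J)) := by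
        calc s t ≤ Real.exp (m t) * J * L := hE
          _ ≤ Real.exp (m t) * J * (s t * M) := by gcongr
          _ = _ := by ring
      nlinarith
    have h6 : (Real.exp (m t) * J * (1 - c)) * |m'| ≤ (Real.exp (m t) * J * (1 - c)) * (192 * M) := by
      have h7 : Real.exp (m t) * ((1 - c) * J) * |m'| ≤ Real.exp (m t) * (2 * I) * |m'| := by
        gcongr
      have h8 : 192 * (1 - c) * 1 ≤ 192 * (1 - c) * (M * (Real.exp (m t) * J)) := by
        have : 0 ≤ 1 - c := by linarith
        gcongr
      nlinarith
    have : 0 < 1 - c := by linarith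
    exact le_of_mul_le_mul_left h6 (by positivity)
  · refine hr1.trans ?_
    rwa [div_le_iff₀ hR] at hRM

/-- Differentiating the constraint R L − s = v gives R L' = s' − r' L, which avoids the factor 1/c
in the direct formula for L'. -/
theorem logDerivBound_capCurv (hκ : 0 < κ) (hS : UniqueDiffWithinAt ℝ S t) (ht : t ∈ S)
    (hm : HasDerivWithinAt m m' S t) (hs : HasDerivWithinAt s s' S t) (h0 : 0 < s t)
    (h1 : s t < 1) (hv : ∀ τ ∈ S, capVol κ (m τ) (s τ) = v)
    (hr : HasDerivWithinAt (fun τ => capWidth κ (m τ) (s τ)) r' S t) (hM : 0 ≤ M)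
    (hs1 : |s'| ≤ 96 * M * s t) (hr1 : |r'| ≤ M * capWidth κ (m t) (s t)) :
    LogDerivBound S t (fun τ => capCurv κ (m τ) (s τ)) (97 * M) := by
  have hL := capCurv_pos hκ (m t) (s t)
  have hR := capWidth_pos hκ (m t) h0
  have hsRL := le_capWidth_mul hκ (m t) h0
  obtain ⟨L', hL'⟩ : ∃ L', HasDerivWithinAt (fun τ => capCurv κ (m τ) (s τ)) L' S t :=
    ⟨_, hasDerivWithinAt_capCurv hκ hm hs h0.le h1⟩
  have hz : HasDerivWithinAt (fun τ => capVol κ (m τ) (s τ)) 0 S t :=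
    (hasDerivWithinAt_const t S v).congr_of_mem (fun τ hτ => hv τ hτ) ht
  have he := hS.eq_deriv _ ((hr.mul hL').sub hs) hz
  refine ⟨L', hL', ?_⟩
  set L := capCurv κ (m t) (s t)
  set R := capWidth κ (m t) (s t)
  have h2 : R * |L'| ≤ R * (97 * M * L) := by
    have h3 : R * L' = s' - r' * L := by linarith
    calc R * |L'| = |s' - r' * L| := by rw [← h3, abs_mul, abs_of_pos hR]
      _ ≤ |s'| + |r' * L| := abs_sub _ _
      _ ≤ 96 * M * s t + M * R * L := by
        rw [abs_mul, abs_of_pos hL]; gcongr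
      _ ≤ 96 * M * (R * L) + M * R * L := by gcongr
      _ = _ := by ring
  exact le_of_mul_le_mul_left h2 hR

theorem logDerivBound_capInt (hκ : 0 < κ) (hm : HasDerivWithinAt m m' S t)
    (hs : HasDerivWithinAt s s' S t) (h0 : 0 < s t) (hM : 0 ≤ M)
    (hs1 : |s'| ≤ 96 * M * s t) (hm1 : |m'| ≤ 192 * M) :
    LogDerivBound S t (fun τ => capInt κ (fun _ => 1) 3 (m τ) (s τ)) (384 * M) := by
  have hL := capCurv_pos hκ (m t) (s t)
  refine ⟨_, hasDerivWithinAt_capInt hκ continuous_const 3 hm hs, ?_⟩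
  have h1 := exp_mul_capInt_le hκ (continuous_const (y := (1 : ℝ))) 3 (m t) h0.le
    fun _ _ => zero_le_one
  have h2 := div_le_capInt_one hκ 3 (m t) h0.le
  have h3 := (capInt_one_pos hκ (3 + 2) (m t) h0).le
  have hE := (Real.exp_pos (m t)).le
  refine (abs_add_le _ _).trans ?_
  rw [abs_mul, abs_mul, abs_neg]
  set J := capInt κ (fun _ => 1) 3 (m t) (s t)
  set J5 := capInt κ (fun _ => 1) (3 + 2) (m t) (s t)
  set L := capCurv κ (m t) (s t)
  have h4 : |(3 : ℕ) / 2 * Real.exp (m t) * J5| ≤ 3 / 2 * J := by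
    rw [abs_of_nonneg (by positivity)]
    push_cast
    linarith
  have h5 : |s'| * |1 / L ^ 3| ≤ 96 * M * J := by
    rw [abs_of_pos (by positivity : 0 < 1 / L ^ 3)]
    calc |s'| * (1 / L ^ 3) ≤ 96 * M * s t * (1 / L ^ 3) := by gcongr
      _ = 96 * M * (s t / L ^ 3) := by ring
      _ ≤ _ := by gcongr
  have h6 : |m'| * |(3 : ℕ) / 2 * Real.exp (m t) * J5| ≤ 192 * M * (3 / 2 * J) := by gcongr
  linarith

/-- The boundary term in s' cancels because the integrand cos y − cos s vanishes at y = s. What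
remains costs (3/2) · 192 from m' and 96 · 2 from c', using (1 − c)J ≤ 2I. -/
theorem logDerivBound_capDefect (hκ : 0 < κ) (hm : HasDerivWithinAt m m' S t)
    (hs : HasDerivWithinAt s s' S t) (h0 : 0 < s t) (h1 : s t < 1) (hM : 0 ≤ M)
    (hc1 : |-(s t / capCos (s t)) * s'| ≤ 96 * M * (1 - capCos (s t))) (hm1 : |m'| ≤ 192 * M) :
    LogDerivBound S t (fun τ => capDefect κ 3 (m τ) (s τ)) (480 * M) := by
  have hd := (hasDerivWithinAt_capInt hκ continuous_capCos 3 hm hs).sub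
    ((hasDerivWithinAt_capCos hs h0.le h1).mul
      (hasDerivWithinAt_capInt hκ (continuous_const (y := (1 : ℝ))) 3 hm hs))
  have h2 : Real.exp (m t) * capDefect κ (3 + 2) (m t) (s t) ≤ capDefect κ 3 (m t) (s t) := by
    rw [capDefect_eq hκ, capDefect_eq hκ]
    exact exp_mul_capInt_le hκ (continuous_capCos.sub continuous_const) 3 (m t) h0.le
      fun y hy => sub_nonneg.2 (capCos_anti hy.1 hy.2)
  have h3 := capDefect_nonneg hκ (3 + 2) (m t) h0.le
  have h4 := mul_le_two_mul_capDefect hκ (m t) h0 h1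
  have hJ := capInt_one_pos hκ 3 (m t) h0
  have hE := Real.exp_pos (m t)
  refine ⟨_, hd.congr_deriv (g' := -(3 / 2 * m' * (Real.exp (m t) *
    capDefect κ (3 + 2) (m t) (s t))) -
      -(s t / capCos (s t)) * s' * capInt κ (fun _ => 1) 3 (m t) (s t)) ?_, ?_⟩
  · unfold capDefect
    push_cast
    ring
  · refine (abs_sub _ _).trans ?_
    rw [abs_neg, abs_mul, abs_mul, abs_mul (-(s t / capCos (s t)) * s'), abs_of_pos hJ,
      abs_of_nonneg (mul_nonneg hE.le h3), abs_of_pos (by norm_num : (0 : ℝ) < 3 / 2)]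
    set J := capInt κ (fun _ => 1) 3 (m t) (s t)
    set I := capDefect κ 3 (m t) (s t)
    have h5 : 3 / 2 * |m'| * (Real.exp (m t) * capDefect κ (3 + 2) (m t) (s t)) ≤
        3 / 2 * (192 * M) * I := by gcongr
    have h6 : |-(s t / capCos (s t)) * s'| * J ≤ 96 * M * (1 - capCos (s t)) * J := by gcongr
    have h7 : 96 * M * ((1 - capCos (s t)) * J) ≤ 96 * M * (2 * I) := by gcongr
    linarith

theorem logDerivBound_capSlope (hκ : 0 < κ) (hS : UniqueDiffWithinAt ℝ S t) (ht : t ∈ S)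
    (hm : HasDerivWithinAt m m' S t) (hs : HasDerivWithinAt s s' S t) (h0 : 0 < s t)
    (h1 : s t < 1) (hv : ∀ τ ∈ S, capVol κ (m τ) (s τ) = v)
    (hr : HasDerivWithinAt (fun τ => capWidth κ (m τ) (s τ)) r' S t) (hr1 : |r'| ≤ 1)
    (hM : 1 / capWidth κ (m t) (s t) + √(2 * κ) ≤ M) :
    LogDerivBound S t (fun τ => capSlope κ (m τ) (s τ)) (83713 * M) := by
  obtain ⟨-, hc', hs', hm', hr'⟩ := cap_rates hκ hS ht hm hs h0 h1 hv hr hr1 hM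
  have hR := capWidth_pos hκ (m t) h0
  have hM0 : 0 ≤ M := le_trans (by positivity) hM
  have hI := capDefect_pos hκ (m t) h0 h1
  have hL := capCurv_pos hκ (m t) (s t)
  have hJ := capInt_one_pos hκ 3 (m t) h0
  have hc := capCos_pos h0.le h1
  have hc1 := capCos_lt_one h0 h1.le
  have hcs := one_sub_capCos_le_sq h0.le h1.le
  have hIJ := capDefect_le hκ (m t) h0.le
  have hsRL := le_capWidth_mul hκ (m t) h0
  have hden := capSlope_denom_ge hκ (m t) h0 h1
  have hden0 := capInt_mul_pos hκ (m t) h0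
  have bL := logDerivBound_capCurv hκ hS ht hm hs h0 h1 hv hr hM0 hs' hr'
  have bJ := logDerivBound_capInt hκ hm hs h0 hM0 hs' hm'
  have bI := logDerivBound_capDefect hκ hm hs h0 h1 hM0 hc' hm'
  have bs : LogDerivBound S t s (96 * M) := ⟨s', hs, hs'⟩
  have bR : LogDerivBound S t (fun τ => capWidth κ (m τ) (s τ)) M := ⟨r', hr, hr'⟩
  have b2 : LogDerivBound S t (fun _ => (2 : ℝ)) 0 := ⟨0, hasDerivWithinAt_const _ _ _, by simp⟩
  have bN := ((b2.mul bI (by positivity) hI.le).mul bs (by positivity) h0.le).mul bL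
    (by positivity) hL.le
  have bP := bJ.mul ((bR.mul bs hR.le h0.le).mul bL (by positivity) hL.le) hJ.le (by positivity)
  -- A difference has no product rule for logarithmic derivatives: its derivative is bounded by (578
  -- + 1152) M times the leading term, and the 1/48 gap turns this into 1730 · 48 = 83040.
  have bD : LogDerivBound S t (fun τ => capInt κ (fun _ => 1) 3 (m τ) (s τ) *
      (capWidth κ (m τ) (s τ) * s τ * capCurv κ (m τ) (s τ)) -
      2 * capDefect κ 3 (m τ) (s τ) * capCos (s τ)) (83040 * M) := by
    obtain ⟨P', hP', hP1⟩ := bP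
    obtain ⟨I', hI', hI1⟩ := bI
    refine ⟨_, hP'.sub ((hI'.const_mul 2).mul (hasDerivWithinAt_capCos hs h0.le h1)), ?_⟩
    refine (abs_sub _ _).trans ?_
    have e1 : |2 * I' * capCos (s t) + 2 * capDefect κ 3 (m t) (s t) *
        (-(s t / capCos (s t)) * s')| ≤ 2 * |I'| * 1 + 2 * capDefect κ 3 (m t) (s t) *
        (96 * M * 1) := by
      refine (abs_add_le _ _).trans ?_
      rw [abs_mul, abs_mul (2 * capDefect κ 3 (m t) (s t)), abs_of_pos hc,
        abs_of_pos (mul_pos two_pos hI), abs_mul, abs_of_pos (two_pos (α := ℝ))]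
      have e2 := hc'.trans (mul_le_mul_of_nonneg_left (by linarith : 1 - capCos (s t) ≤ 1)
        (by positivity : 0 ≤ 96 * M))
      gcongr
    set I := capDefect κ 3 (m t) (s t)
    set J := capInt κ (fun _ => 1) 3 (m t) (s t)
    set L := capCurv κ (m t) (s t)
    set R := capWidth κ (m t) (s t)
    have e3 : I ≤ J * (R * s t * L) := by
      calc I ≤ (1 - capCos (s t)) * J := hIJ
        _ ≤ s t ^ 2 * J := by gcongr
        _ = J * (s t * s t) := by ring
        _ ≤ J * (R * L * s t) := by gcongr
        _ = _ := by ring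
    have e4 : 1152 * M * I ≤ 1152 * M * (J * (R * s t * L)) := by gcongr
    have e5 : 83040 * M * (J * (R * s t * L) / 48) ≤
      83040 * M * (J * (R * s t * L) - 2 * I * capCos (s t)) := by gcongr
    have e6 : 2 * |I'| ≤ 2 * (480 * M * I) := by gcongr
    linarith
  -- The numerator contributes 480 + 96 + 97 = 673, and 673 + 83040 = 83713.
  have bΦ := bN.div bD (by positivity) (by linarith)
  obtain ⟨f', hf, hf1⟩ := bΦ
  refine ⟨f', hf, hf1.trans (le_of_eq ?_)⟩
  unfold capSlope
  ring

end Path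

/-! ### Time regularity of the exact evolution -/

/-- Along a droplet evolution the cosine of the contact angle is twice differentiable, with bounds
depending only on `M`. -/
theorem contact_regularity {κ v σ T M : ℝ} (hκ : 0 < κ) (hσ : -1 < σ) (hσ0 : σ ≤ 0) (hT : 0 < T)
    {r c : ℝ → ℝ} (hr : ∀ t ∈ Icc 0 T, HasDerivWithinAt r (-(σ + c t)) (Icc 0 T) t)
    (hc : DifferentiableOn ℝ c (Icc 0 T))
    (hcap : ∀ t ∈ Icc 0 T, ∃ m s, IsCap κ v m s (r t) (c t))
    (hM : ∀ t ∈ Icc 0 T, 1 / r t + √(2 * κ) ≤ M) :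
    ∃ q : ℝ → ℝ, (∀ t ∈ Icc 0 T, HasDerivWithinAt c (q t) (Icc 0 T) t ∧ |q t| ≤ 96 * M) ∧
      ∀ t ∈ Icc 0 T, ∃ q', HasDerivWithinAt q q' (Icc 0 T) t ∧ |q'| ≤ 10 ^ 7 * M ^ 2 := by
  set S := Icc (0 : ℝ) T with hSdef
  -- The cap parameters are recovered from r and c by explicit formulas, L being (v + s)/r, so they
  -- inherit differentiability in time.
  set s : ℝ → ℝ := fun t => √(1 - c t ^ 2) with hs
  set m : ℝ → ℝ := fun t => Real.log (((v + s t) / r t) ^ 2 - 2 * κ * (1 - c t)) with hm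
  have hcap' : ∀ t ∈ S, IsCap κ v (m t) (s t) (r t) (c t) ∧
      0 < ((v + s t) / r t) ^ 2 - 2 * κ * (1 - c t) := by
    intro t ht
    obtain ⟨m₀, s₀, h⟩ := hcap t ht
    have hsq := capCos_sq h.pos.le h.lt_one.le
    have hs0 : s t = s₀ := by
      simp only [hs]
      rw [h.cos, hsq, sub_sub_cancel, Real.sqrt_sq h.pos.le]
    have hR := capWidth_pos hκ m₀ h.pos
    have hL : (v + s t) / r t = capCurv κ m₀ s₀ := by
      rw [hs0, h.width, div_eq_iff hR.ne', ← h.vol, capVol]; ring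
    have hk : ((v + s t) / r t) ^ 2 - 2 * κ * (1 - c t) = Real.exp m₀ := by
      rw [hL, capCurv_sq hκ, h.cos]; ring
    have hm0 : m t = m₀ := by
      simp only [hm]; rw [hk, Real.log_exp]
    refine ⟨by rw [hm0, hs0]; exact h, by rw [hk]; exact Real.exp_pos _⟩
  have hU : UniqueDiffOn ℝ S := uniqueDiffOn_Icc hT
  have hcpos : ∀ t ∈ S, 0 < c t ∧ c t < 1 := by
    intro t ht
    have h := (hcap' t ht).1
    rw [h.cos]
    exact ⟨capCos_pos h.pos.le h.lt_one, capCos_lt_one h.pos h.lt_one.le⟩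
  have hrpos : ∀ t ∈ S, 0 < r t := by
    intro t ht
    have h := (hcap' t ht).1
    rw [h.width]
    exact capWidth_pos hκ _ h.pos
  have hsd : DifferentiableOn ℝ s S := by
    intro t ht
    refine (((hc t ht).fun_pow 2).const_sub 1).sqrt ?_
    obtain ⟨h1, h2⟩ := hcpos t ht
    nlinarith
  have hmd : DifferentiableOn ℝ m S := by
    intro t ht
    refine DifferentiableWithinAt.log ?_ (hcap' t ht).2.ne'
    exact ((((hsd t ht).const_add v).fun_div (hr t ht).differentiableWithinAt
      (hrpos t ht).ne').fun_pow 2).fun_sub (((hc t ht).const_sub 1).const_mul (2 * κ))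
  have hv : ∀ τ ∈ S, capVol κ (m τ) (s τ) = v := fun τ hτ => (hcap' τ hτ).1.vol
  have hrw : ∀ t ∈ S, HasDerivWithinAt (fun τ => capWidth κ (m τ) (s τ)) (-(σ + c t)) S t :=
    fun t ht => (hr t ht).congr_of_mem (fun τ hτ => (hcap' τ hτ).1.width.symm) ht
  have hr1 : ∀ t ∈ S, |-(σ + c t)| ≤ 1 := by
    intro t ht
    obtain ⟨h1, h2⟩ := hcpos t ht
    rw [abs_le]; constructor <;> linarith
  have hMw : ∀ t ∈ S, 1 / capWidth κ (m t) (s t) + √(2 * κ) ≤ M := by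
    intro t ht
    rw [← (hcap' t ht).1.width]; exact hM t ht
  have hrates := fun t (ht : t ∈ S) => cap_rates hκ (hU t ht) ht (hmd t ht).hasDerivWithinAt
    (hsd t ht).hasDerivWithinAt (hcap' t ht).1.pos (hcap' t ht).1.lt_one hv (hrw t ht)
    (hr1 t ht) (hMw t ht)
  have hM0 : 0 ≤ M := by
    have h0 : (0 : ℝ) ∈ S := ⟨le_rfl, hT.le⟩
    have := hrpos 0 h0
    exact le_trans (by positivity) (hM 0 h0)
  have hΦle : ∀ t ∈ S, capSlope κ (m t) (s t) ≤ 96 * M := by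
    intro t ht
    have h := (hcap' t ht).1
    have hR := capWidth_pos hκ (m t) h.pos
    have hRM : 1 / capWidth κ (m t) (s t) ≤ M := by
      have := Real.sqrt_nonneg (2 * κ); linarith [hMw t ht]
    refine (capSlope_le hκ (m t) h.pos h.lt_one).trans ?_
    have h1 := capCos_nonneg (s t)
    calc 96 * (1 - capCos (s t)) / capWidth κ (m t) (s t) ≤ 96 * 1 / capWidth κ (m t) (s t) := by
          gcongr; linarith
      _ = 96 * (1 / capWidth κ (m t) (s t)) := by ring
      _ ≤ _ := by gcongr
  have hq : ∀ t ∈ S, HasDerivWithinAt c (capSlope κ (m t) (s t) * -(σ + c t)) S t := by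
    intro t ht
    have h := (hcap' t ht).1
    rw [← (hrates t ht).1]
    exact (hasDerivWithinAt_capCos (hsd t ht).hasDerivWithinAt h.pos.le h.lt_one).congr_of_mem
      (fun τ hτ => (hcap' τ hτ).1.cos) ht
  have hqle : ∀ t ∈ S, |capSlope κ (m t) (s t) * -(σ + c t)| ≤ 96 * M := by
    intro t ht
    have h := (hcap' t ht).1
    have h0 := capSlope_nonneg hκ (m t) h.pos h.lt_one
    rw [abs_mul, abs_of_nonneg h0]
    calc _ ≤ capSlope κ (m t) (s t) * 1 := by gcongr; exact hr1 t ht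
      _ ≤ _ := by linarith [hΦle t ht]
  refine ⟨fun t => capSlope κ (m t) (s t) * -(σ + c t), fun t ht => ⟨hq t ht, hqle t ht⟩,
    fun t ht => ?_⟩
  have h := (hcap' t ht).1
  have h0 := capSlope_nonneg hκ (m t) h.pos h.lt_one
  obtain ⟨Φ', hΦ', hΦ1⟩ := logDerivBound_capSlope hκ (hU t ht) ht (hmd t ht).hasDerivWithinAt
    (hsd t ht).hasDerivWithinAt h.pos h.lt_one hv (hrw t ht) (hr1 t ht) (hMw t ht)
  refine ⟨_, hΦ'.mul ((hq t ht).const_add σ).fun_neg, ?_⟩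
  refine (abs_add_le _ _).trans ?_
  rw [abs_mul, abs_mul (capSlope κ (m t) (s t)), abs_neg (capSlope κ (m t) (s t) * -(σ + c t)),
    abs_of_nonneg h0]
  have e1 : |Φ'| * |-(σ + c t)| ≤ 83713 * M * (96 * M) * 1 := by
    have := hΦ1.trans (mul_le_mul_of_nonneg_left (hΦle t ht) (by positivity : 0 ≤ 83713 * M))
    have := hr1 t ht
    gcongr
  have e2 : capSlope κ (m t) (s t) * |capSlope κ (m t) (s t) * -(σ + c t)| ≤
      96 * M * (96 * M) := by
    have := hqle t ht
    have := hΦle t ht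
    gcongr
  -- 83713 · 96 + 96² is below 10⁷.
  nlinarith [sq_nonneg M]

/-! ### Error analysis of Heun's method -/

section Heun

variable {σ T L K : ℝ} {r c q : ℝ → ℝ}

theorem euler_consistency (hr : ∀ t ∈ Icc 0 T, HasDerivWithinAt r (-(σ + c t)) (Icc 0 T) t)
    (hc : ∀ t ∈ Icc 0 T, HasDerivWithinAt c (q t) (Icc 0 T) t ∧ |q t| ≤ L) {t h : ℝ}
    (ht : 0 ≤ t) (hh : 0 ≤ h) (hT : t + h ≤ T) :
    |r (t + h) - (r t - h * (σ + c t))| ≤ L * h ^ 2 := by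
  have hsub : Icc t (t + h) ⊆ Icc 0 T := Icc_subset_Icc ht hT
  have hl : t ∈ Icc t (t + h) := ⟨le_rfl, by linarith⟩
  have hL : 0 ≤ L := (abs_nonneg _).trans (hc t (hsub hl)).2
  have hcl : ∀ x ∈ Icc t (t + h), |c x - c t| ≤ L * h := by
    intro x hx
    have := (convex_Icc t (t + h)).norm_image_sub_le_of_norm_hasDerivWithin_le
      (fun y hy => (hc y (hsub hy)).1.mono hsub) (fun y hy => (hc y (hsub hy)).2) hl hx
    refine this.trans ?_
    rw [Real.norm_eq_abs, abs_of_nonneg (sub_nonneg.2 hx.1)]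
    have := hx.2
    gcongr
    linarith
  have key := (convex_Icc t (t + h)).norm_image_sub_le_of_norm_hasDerivWithin_le
    (f := fun x => r x + (σ + c t) * x) (f' := fun x => -(σ + c x) + (σ + c t) * 1) (C := L * h)
    (fun y hy => ((hr y (hsub hy)).mono hsub).add
      ((hasDerivWithinAt_id y _).const_mul (σ + c t)))
    (fun y hy => by
      have := hcl y hy
      rw [abs_sub_comm] at this
      rw [Real.norm_eq_abs]
      convert this using 2
      ring) hl ⟨by linarith, le_rfl⟩
  rw [Real.norm_eq_abs, Real.norm_eq_abs, add_sub_cancel_left, abs_of_nonneg hh] at key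
  calc _ = |r (t + h) + (σ + c t) * (t + h) - (r t + (σ + c t) * t)| := by congr 1; ring
    _ ≤ _ := key
    _ = _ := by ring

theorem trapezoid_consistency
    (hr : ∀ t ∈ Icc 0 T, HasDerivWithinAt r (-(σ + c t)) (Icc 0 T) t)
    (hc : ∀ t ∈ Icc 0 T, HasDerivWithinAt c (q t) (Icc 0 T) t)
    (hq : ∀ t ∈ Icc 0 T, ∃ q', HasDerivWithinAt q q' (Icc 0 T) t ∧ |q'| ≤ K) {t h : ℝ}
    (ht : 0 ≤ t) (hh : 0 ≤ h) (hT : t + h ≤ T) :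
    |r (t + h) - (r t - h * (σ + (c t + c (t + h)) / 2))| ≤ K / 2 * h ^ 3 := by
  have hsub : Icc t (t + h) ⊆ Icc 0 T := Icc_subset_Icc ht hT
  have hl : t ∈ Icc t (t + h) := ⟨le_rfl, by linarith⟩
  choose! q' hq' hq'K using hq
  have hK : 0 ≤ K := (abs_nonneg _).trans (hq'K t (hsub hl))
  have hql : ∀ x ∈ Icc t (t + h), ∀ y ∈ Icc t (t + h), |q x - q y| ≤ K * h := by
    intro x hx y hy
    have := (convex_Icc t (t + h)).norm_image_sub_le_of_norm_hasDerivWithin_le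
      (fun y hy => (hq' y (hsub hy)).mono hsub) (fun y hy => hq'K y (hsub hy)) hy hx
    refine this.trans ?_
    have : ‖x - y‖ ≤ h := by
      rw [Real.norm_eq_abs, abs_le]
      constructor <;> linarith [hx.1, hx.2, hy.1, hy.2]
    gcongr
  have hct : ∀ x ∈ Icc t (t + h), |c t - c x + (x - t) * q x| ≤ K * h ^ 2 := by
    intro x hx
    have key := (convex_Icc t (t + h)).norm_image_sub_le_of_norm_hasDerivWithin_le
      (f := fun y => c y - q x * y) (f' := fun y => q y - q x * 1) (C := K * h)
      (fun y hy => ((hc y (hsub hy)).mono hsub).sub ((hasDerivWithinAt_id y _).const_mul (q x)))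
      (fun y hy => by simpa using hql y hy x hx) hx hl
    rw [Real.norm_eq_abs, Real.norm_eq_abs, abs_sub_comm t, abs_of_nonneg (sub_nonneg.2 hx.1)] at key
    calc _ = |c t - q x * t - (c x - q x * x)| := by congr 1; ring
      _ ≤ _ := key
      _ ≤ K * h * h := by
        have := hx.2
        gcongr
        linarith
      _ = _ := by ring
  -- The defect of the trapezoidal rule, viewed as a function of the right endpoint, has derivative
  -- (c(t) − c(x) + (x − t)c'(x))/2, a Taylor remainder.
  have key := (convex_Icc t (t + h)).norm_image_sub_le_of_norm_hasDerivWithin_le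
    (f := fun x => r x + (x - t) * (σ + (c t + c x) / 2))
    (f' := fun x => -(σ + c x) + (1 * (σ + (c t + c x) / 2) + (x - t) * (q x / 2)))
    (C := K / 2 * h ^ 2)
    (fun y hy => ((hr y (hsub hy)).mono hsub).add
      (((hasDerivWithinAt_id y _).sub_const t).mul
        (((((hc y (hsub hy)).mono hsub).const_add (c t)).div_const 2).const_add σ)))
    (fun y hy => by
      have := hct y hy
      rw [Real.norm_eq_abs]
      have e : -(σ + c y) + (1 * (σ + (c t + c y) / 2) + (y - t) * (q y / 2)) =
        (c t - c y + (y - t) * q y) / 2 := by ring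
      rw [e, abs_div, abs_two]
      linarith) hl ⟨by linarith, le_rfl⟩
  rw [Real.norm_eq_abs, Real.norm_eq_abs, add_sub_cancel_left, abs_of_nonneg hh] at key
  calc _ = |r (t + h) + h * (σ + (c t + c (t + h)) / 2) -
        (r t + (t - t) * (σ + (c t + c t) / 2))| := by congr 1; ring
    _ ≤ _ := key
    _ = _ := by ring

/-- Error of the predictor-corrector scheme for a scalar evolution. -/
theorem heun_error {Δ : ℝ} {N : ℕ} (hΔ : 0 ≤ Δ) (hN : N * Δ ≤ T)
    (hr : ∀ t ∈ Icc 0 T, HasDerivWithinAt r (-(σ + c t)) (Icc 0 T) t)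
    (hc : ∀ t ∈ Icc 0 T, HasDerivWithinAt c (q t) (Icc 0 T) t ∧ |q t| ≤ L)
    (hq : ∀ t ∈ Icc 0 T, ∃ q', HasDerivWithinAt q q' (Icc 0 T) t ∧ |q'| ≤ K)
    {ρ γ ρ' γ' : ℕ → ℝ} (h0 : ρ 0 = r 0)
    (hγ : ∀ n < N, |c (n * Δ) - γ n| ≤ L * |r (n * Δ) - ρ n|)
    (hγ' : ∀ n < N, |c ((n + 1 : ℕ) * Δ) - γ' (n + 1)| ≤ L * |r ((n + 1 : ℕ) * Δ) - ρ' (n + 1)|)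
    (hp : ∀ n < N, ρ' (n + 1) = ρ n - Δ * (σ + γ n))
    (hs : ∀ n < N, ρ (n + 1) = ρ n - Δ * (σ + (γ n + γ' (n + 1)) / 2)) :
    ∀ n ≤ N, |r (n * Δ) - ρ n| ≤ n * Real.exp (L * Δ) ^ n * ((L ^ 2 + K) / 2 * Δ ^ 3) := by
  have hT : 0 ≤ T := le_trans (by positivity) hN
  have hL : 0 ≤ L := (abs_nonneg _).trans (hc 0 ⟨le_rfl, hT⟩).2
  have hK : 0 ≤ K := by
    obtain ⟨q', -, h⟩ := hq 0 ⟨le_rfl, hT⟩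
    exact (abs_nonneg _).trans h
  intro n
  induction n with
  | zero => intro _; simp [h0]
  | succ n ih =>
    intro hn
    have hn' : n < N := hn
    have ih := ih hn'.le
    have htn : (0 : ℝ) ≤ n * Δ := by positivity
    have hcast : ((n + 1 : ℕ) : ℝ) * Δ = n * Δ + Δ := by push_cast; ring
    have hnT : (n : ℝ) * Δ + Δ ≤ T := by
      rw [← hcast]
      refine le_trans ?_ hN
      gcongr
    have e1 := euler_consistency hr hc htn hΔ hnT
    have e2 := trapezoid_consistency hr (fun t ht => (hc t ht).1) hq htn hΔ hnT
    have g1 := hγ n hn'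
    have g2 := hγ' n hn'
    rw [hcast] at g2 ⊢
    rw [hp n hn'] at g2
    rw [hs n hn']
    set t := (n : ℝ) * Δ
    set e := |r t - ρ n| with he
    have he0 : 0 ≤ e := abs_nonneg _
    have p1 : |r (t + Δ) - (ρ n - Δ * (σ + γ n))| ≤ L * Δ ^ 2 + (e + Δ * (L * e)) := by
      calc _ = |(r (t + Δ) - (r t - Δ * (σ + c t))) + ((r t - ρ n) - Δ * (c t - γ n))| := by
            congr 1; ring
        _ ≤ |r (t + Δ) - (r t - Δ * (σ + c t))| + (|r t - ρ n| + |Δ * (c t - γ n)|) :=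
            (abs_add_le _ _).trans (by gcongr; exact abs_sub _ _)
        _ ≤ _ := by
          rw [abs_mul, abs_of_nonneg hΔ]
          gcongr
    have p2 : |r (t + Δ) - (ρ n - Δ * (σ + (γ n + γ' (n + 1)) / 2))| ≤
        K / 2 * Δ ^ 3 + (e + Δ / 2 * (L * e + L * (L * Δ ^ 2 + (e + Δ * (L * e))))) := by
      calc _ = |(r (t + Δ) - (r t - Δ * (σ + (c t + c (t + Δ)) / 2))) +
            ((r t - ρ n) - Δ / 2 * ((c t - γ n) + (c (t + Δ) - γ' (n + 1))))| := by
            congr 1; ring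
        _ ≤ |r (t + Δ) - (r t - Δ * (σ + (c t + c (t + Δ)) / 2))| +
            (|r t - ρ n| + |Δ / 2 * ((c t - γ n) + (c (t + Δ) - γ' (n + 1)))|) :=
            (abs_add_le _ _).trans (by gcongr; exact abs_sub _ _)
        _ ≤ _ := by
          rw [abs_mul, abs_of_nonneg (by positivity : 0 ≤ Δ / 2)]
          have := abs_add_le (c t - γ n) (c (t + Δ) - γ' (n + 1))
          have := g2.trans (mul_le_mul_of_nonneg_left p1 hL)
          gcongr
          linarith
    -- The previous estimate is the recursion e ↦ (1 + LΔ + (LΔ)²/2) e + B: the predictor's error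
    -- LΔ² is damped by the factor LΔ/2 and joins the Δ³ term.
    have hexp : 1 + L * Δ + (L * Δ) ^ 2 / 2 ≤ Real.exp (L * Δ) :=
      Real.quadratic_le_exp_of_nonneg (by positivity)
    have hexp1 : 1 ≤ Real.exp (L * Δ) := Real.one_le_exp (by positivity)
    set X := Real.exp (L * Δ)
    set B := (L ^ 2 + K) / 2 * Δ ^ 3 with hB
    have hB0 : 0 ≤ B := by positivity
    have p3 : (1 + L * Δ + (L * Δ) ^ 2 / 2) * e ≤ X * (n * X ^ n * B) := by gcongr
    have p4 : B ≤ X ^ (n + 1) * B := le_mul_of_one_le_left hB0 (one_le_pow₀ hexp1)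
    calc _ ≤ (1 + L * Δ + (L * Δ) ^ 2 / 2) * e + B := p2.trans (by rw [hB]; apply le_of_eq; ring)
      _ ≤ X * (n * X ^ n * B) + X ^ (n + 1) * B := add_le_add p3 p4
      _ = _ := by push_cast; ring

end Heun

/-! ### Assembly -/

theorem profile_congr {κ V a b lam : ℝ} {u w : ℝ → ℝ} (h : IsQuasiStaticProfile κ V a b u lam)
    (he : EqOn w u (Icc a b)) : IsQuasiStaticProfile κ V a b w lam where
  lt := h.lt
  smooth := h.smooth.congr he
  equation x hx := by
    have hev : w =ᶠ[nhds x] u := by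
      filter_upwards [Icc_mem_nhds hx.1 hx.2] with y hy using he hy
    have hev2 : (fun y => deriv w y / √(1 + deriv w y ^ 2)) =ᶠ[nhds x]
        fun y => deriv u y / √(1 + deriv u y ^ 2) := by
      filter_upwards [hev.deriv] with y hy
      rw [hy]
    rw [hev2.deriv_eq, he (Ioo_subset_Icc_self hx)]
    exact h.equation x hx
  left := (he (left_mem_Icc.2 h.lt.le)).trans h.left
  right := (he (right_mem_Icc.2 h.lt.le)).trans h.right
  volume := by
    rw [← h.volume]
    apply intervalIntegral.integral_congr
    rwa [uIcc_of_le h.lt.le]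

/-- One power of Δ is spent on nΔ ≤ T, and the factor BT is absorbed by exp(BT). -/
theorem error_constant_le {Cm T Δ B L : ℝ} (hT : 0 ≤ T) {n : ℕ} (hn : n * Δ ≤ T)
    (hL : 0 ≤ L) (hB : 0 ≤ B) (hLC : L ≤ 96 * |Cm|) (hBC : B ≤ 10 ^ 7 * Cm ^ 2) :
    n * Real.exp (L * Δ) ^ n * (B * Δ ^ 3) ≤
      (1 + 96 * |Cm| + 10 ^ 7 * Cm ^ 2) *
        Real.exp ((1 + 96 * |Cm| + 10 ^ 7 * Cm ^ 2) * T) * Δ ^ 2 := by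
  set C := 1 + 96 * |Cm| + 10 ^ 7 * Cm ^ 2 with hC
  have hCm : 0 ≤ |Cm| := abs_nonneg _
  have hC1 : 1 ≤ C := by rw [hC]; nlinarith [sq_nonneg Cm]
  have hBLC : B + L ≤ C := by rw [hC]; linarith
  have e1 : Real.exp (L * Δ) ^ n ≤ Real.exp (L * T) := by
    rw [← Real.exp_nat_mul]
    apply Real.exp_le_exp.2
    calc (n : ℝ) * (L * Δ) = L * (n * Δ) := by ring
      _ ≤ _ := by gcongr
  have e2 : B * T ≤ Real.exp (B * T) := by
    have := Real.add_one_le_exp (B * T); linarith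
  calc n * Real.exp (L * Δ) ^ n * (B * Δ ^ 3) = B * (n * Δ) * Real.exp (L * Δ) ^ n * Δ ^ 2 := by ring
    _ ≤ B * T * Real.exp (L * T) * Δ ^ 2 := by gcongr
    _ ≤ Real.exp (B * T) * Real.exp (L * T) * Δ ^ 2 := by gcongr
    _ = 1 * Real.exp ((B + L) * T) * Δ ^ 2 := by rw [← Real.exp_add, one_mul]; ring_nf
    _ ≤ C * Real.exp (C * T) * Δ ^ 2 := by gcongr

end Capillary

open Capillary

theorem mainTheorem2 :
    ∀ Cm : ℝ, ∃ C : ℝ, 0 < C ∧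
      ∀ (σ κ V T : ℝ) (_ : -1 < σ) (_ : σ ≤ 0) (_ : 0 < κ) (_ : 0 < V) (_ : 0 < T)
        (a b : ℝ → ℝ) (u : ℝ → ℝ → ℝ) (lam : ℝ → ℝ)
        (_ : ContDiffOn ℝ 3 a (Set.Icc 0 T)) (_ : ContDiffOn ℝ 3 b (Set.Icc 0 T))
        (_ : IsQuasiStaticSolution σ κ V T a b u lam)
        (_ : ∀ t ∈ Set.Icc 0 T, angleSlopeBound κ V (a t) (b t) (u t) ≤ Cm)
        (Δt : ℝ) (_ : 0 < Δt) (N : ℕ) (_ : (N : ℝ) < T / Δt)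
        (an bn : ℕ → ℝ) (un : ℕ → ℝ → ℝ) (lamn : ℕ → ℝ)
        (ap bp : ℕ → ℝ) (up : ℕ → ℝ → ℝ) (lamp : ℕ → ℝ)
        (_ : an 0 = a 0) (_ : bn 0 = b 0) (_ : Set.EqOn (un 0) (u 0) (Set.Icc (a 0) (b 0)))
        (_ : IsPredictorCorrector σ κ Δt N an bn un lamn ap bp up lamp),
        ∀ n ≤ N,
          |b (n * Δt) - bn n| ≤ C * Real.exp (C * T) * Δt ^ 2 ∧
          |a (n * Δt) - an n| ≤ C * Real.exp (C * T) * Δt ^ 2 := by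
  intro Cm
  -- 96 C_m is the Lipschitz constant L and 10⁷ C_m² the bound K on the second derivative; it also
  -- covers (L² + K)/2.
  refine ⟨1 + 96 * |Cm| + 10 ^ 7 * Cm ^ 2, by positivity, ?_⟩
  intro σ κ V T hσ hσ0 hκ hV hT a b u lam ha hb hsol hCm Δt hΔ N hN an bn un lamn ap bp up lamp
    ha0 hb0 hu0 hpc
  rw [lt_div_iff₀ hΔ] at hN
  have hz : (0 : ℝ) ∈ Icc 0 T := ⟨le_rfl, hT.le⟩
  have hprof0 := hsol.profile 0 hz
  have hgeom : ∀ {a' b' lam' : ℝ} {u' : ℝ → ℝ}, IsQuasiStaticProfile κ V a' b' u' lam' →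
      1 / ((b' - a') / 2) + √(2 * κ) ≤ Cm := fun h => inv_add_sqrt_le hκ hV hprof0 (hCm 0 hz) h
  have hwid : ∀ {a' b' lam' : ℝ} {u' : ℝ → ℝ}, IsQuasiStaticProfile κ V a' b' u' lam' →
      1 / ((b' - a') / 2) ≤ Cm := fun h => by
    have := hgeom h
    have := Real.sqrt_nonneg (2 * κ)
    linarith
  have hCm0 : 0 ≤ Cm := by
    have := hprof0.lt
    have h1 : 0 < (b 0 - a 0) / 2 := by linarith
    exact le_trans (by positivity) (hwid hprof0)
  -- the volume prescribed by the scheme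
  have hun0 : IsQuasiStaticProfile κ V (an 0) (bn 0) (un 0) (lam 0) := by
    rw [ha0, hb0]; exact profile_congr hprof0 hu0
  have hvol : ∫ x in (an 0)..(bn 0), un 0 x = V := hun0.volume
  have hpred := hpc.predictor
  have hpn := hpc.profile
  simp only [hvol] at hpred hpn
  have hprofn : ∀ n ≤ N, ∃ l, IsQuasiStaticProfile κ V (an n) (bn n) (un n) l := by
    intro n hn
    rcases n with _ | n
    · exact ⟨_, hun0⟩
    · exact ⟨_, hpn n hn⟩
  -- comparison of the contact angles of two profiles
  have hlip : ∀ {a₁ b₁ l₁ a₂ b₂ l₂ : ℝ} {u₁ u₂ : ℝ → ℝ},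
      IsQuasiStaticProfile κ V a₁ b₁ u₁ l₁ → IsQuasiStaticProfile κ V a₂ b₂ u₂ l₂ →
      |cosLeft a₁ b₁ u₁ - cosLeft a₂ b₂ u₂| ≤ 96 * Cm * |(b₁ - a₁) / 2 - (b₂ - a₂) / 2| := by
    intro a₁ b₁ l₁ a₂ b₂ l₂ u₁ u₂ h₁ h₂
    obtain ⟨m₁, s₁, c₁, -⟩ := exists_isCap hκ hV h₁
    obtain ⟨m₂, s₂, c₂, -⟩ := exists_isCap hκ hV h₂
    exact c₂.abs_sub_le hκ c₁ (hwid h₂) (hwid h₁)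
  set r : ℝ → ℝ := fun t => (b t - a t) / 2 with hr_def
  set c : ℝ → ℝ := fun t => cosLeft (a t) (b t) (u t) with hc_def
  have hbder : ∀ t ∈ Icc 0 T, HasDerivWithinAt b (-σ - c t) (Icc 0 T) t := by
    intro t ht
    have := hsol.right t ht
    rwa [cosRight_eq_cosLeft (hsol.profile t ht)] at this
  have hr : ∀ t ∈ Icc 0 T, HasDerivWithinAt r (-(σ + c t)) (Icc 0 T) t := fun t ht =>
    (((hbder t ht).sub (hsol.left t ht)).div_const 2).congr_deriv (by simp only [hc_def]; ring)
  have hU := uniqueDiffOn_Icc hT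
  -- Differentiability of c is read off from c = a' − σ and the smoothness of `a`; quantitative
  -- bounds come only from the cap geometry.
  have hcd : DifferentiableOn ℝ c (Icc 0 T) := by
    have h1 : ContDiffOn ℝ 2 (derivWithin a (Icc 0 T)) (Icc 0 T) :=
      ha.derivWithin hU (by norm_num)
    refine ((h1.differentiableOn two_ne_zero).sub_const σ).congr fun t ht => ?_
    rw [(hsol.left t ht).derivWithin (hU t ht)]
    simp only [hc_def]
    ring
  obtain ⟨q, hq, hq'⟩ := contact_regularity (v := κ * V / 2) hκ hσ hσ0 hT hr hcd
    (fun t ht => by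
      obtain ⟨m, s, h, -⟩ := exists_isCap hκ hV (hsol.profile t ht)
      exact ⟨m, s, h⟩)
    (fun t ht => hgeom (hsol.profile t ht))
  have hmem : ∀ n ≤ N, (n : ℝ) * Δt ∈ Icc 0 T := fun n hn =>
    ⟨by positivity, le_trans (by gcongr) hN.le⟩
  have hstep : ∀ {x y z : ℝ}, (x - y) / Δt = z → x = y + Δt * z := by
    intro x y z h
    rw [div_eq_iff hΔ.ne'] at h
    linarith
  have hcosn : ∀ n ≤ N, cosRight (an n) (bn n) (un n) = cosLeft (an n) (bn n) (un n) := by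
    intro n hn
    obtain ⟨l, hl⟩ := hprofn n hn
    exact cosRight_eq_cosLeft hl
  have herr := heun_error (N := N) (ρ := fun n => (bn n - an n) / 2)
    (γ := fun n => cosLeft (an n) (bn n) (un n)) (ρ' := fun n => (bp n - ap n) / 2)
    (γ' := fun n => cosLeft (ap n) (bp n) (up n)) hΔ.le hN.le hr hq hq'
    (by simp only [hr_def, ha0, hb0])
    (fun n hn => by
      obtain ⟨l, hl⟩ := hprofn n hn.le
      exact hlip (hsol.profile _ (hmem n hn.le)) hl)
    (fun n hn => hlip (hsol.profile _ (hmem (n + 1) hn)) (hpred n hn).profile)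
    (fun n hn => by
      have h1 := hstep (hpred n hn).left
      have h2 := hstep (hpred n hn).right
      rw [hcosn n hn.le] at h2
      simp only [h1, h2]
      ring)
    (fun n hn => by
      have h1 := hstep (hpc.left n hn)
      have h2 := hstep (hpc.right n hn)
      rw [hcosn n hn.le, cosRight_eq_cosLeft (hpred n hn).profile] at h2
      simp only [h1, h2]
      ring)
  -- the midpoints do not move
  have hmid : ∀ t ∈ Icc 0 T, a t + b t = a 0 + b 0 := by
    intro t ht
    refine constant_of_hasDerivAt_zero (f := fun t => a t + b t)
      (ha.continuousOn.add hb.continuousOn) (fun x hx => ?_) ht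
    have hx' := Ioo_subset_Icc_self hx
    exact (((hsol.left x hx').add (hbder x hx')).hasDerivAt (Icc_mem_nhds hx.1 hx.2)).congr_deriv
      (by simp only [hc_def]; ring)
  have hmidn : ∀ n ≤ N, an n + bn n = a 0 + b 0 := by
    intro n
    induction n with
    | zero => intro _; rw [ha0, hb0]
    | succ n ih =>
      intro hn
      have h1 := hstep (hpc.left n hn)
      have h2 := hstep (hpc.right n hn)
      rw [hcosn n (Nat.le_of_succ_le hn), cosRight_eq_cosLeft (hpred n hn).profile] at h2
      rw [← ih (Nat.le_of_succ_le hn), h1, h2]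
      ring
  intro n hn
  have hfin : |r (n * Δt) - (bn n - an n) / 2| ≤ _ := (herr n hn).trans
    (error_constant_le (Cm := Cm) hT.le (hmem n hn).2 (by positivity) (by positivity)
      (by rw [abs_of_nonneg hCm0]) (by nlinarith [sq_nonneg Cm]))
  have h1 := hmid _ (hmem n hn)
  have h2 := hmidn n hn
  have hb' : b (n * Δt) - bn n = r (n * Δt) - (bn n - an n) / 2 := by
    simp only [hr_def]; linarith
  have ha' : a (n * Δt) - an n = -(r (n * Δt) - (bn n - an n) / 2) := by
    simp only [hr_def]; linarith
  rw [hb', ha', abs_neg]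
  exact ⟨hfin, hfin⟩
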